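/- Let $m,d\ge 0$ be integers. For $K\in\{\mathbb R,\mathbb C\}$ let $\mathbb P^N(K)$, $N=\binom{m+d}{d}-1$, be the projective space of homogeneous polynomials of degree $d$ in $m+1$ variables over $K$, and let $\nu_d:\mathbb P^m(K)\to\mathbb P^N(K)$ be the Veronese map $[L]\mapsto[L^d]$, where points of $\mathbb P^m$ are identified with linear forms up to scalars. Real points are regarded as complex points, and $\langle\ \rangle$ denotes the complex linear span. For $P\in\mathbb P^N(\mathbb C)$, $r_{\mathbb C}(P)$ is the least cardinality of a finite set $S\subset\mathbb P^m(\mathbb C)$ with $P\in\langle\nu_d(S)\rangle$; for $P\in\mathbb P^N(\mathbb R)$, $r_{\mathbb R}(P)$ is the least cardinality of a finite set $S\subset\mathbb P^m(\mathbb R)$ such that $P$ lies in the real linear span of $\nu_d(S)$. A finite set that attains the minimum is said to evince the rank. For a finite set $S\subset\mathbb P^m(\mathbb C)$ and $Z\subset\mathbb P^m(\mathbb C)$ write $S_Z=S\cap Z$; write $S_{\mathbb C,Z}$ and $S_{\mathbb R,Z}$ for $(S_{\mathbb C})_Z$ and $(S_{\mathbb R})_Z$. **Theorem.** Let $P\in\mathbb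 P^N(\mathbb R)$ be such that $r_{\mathbb C}(P)\ne r_{\mathbb R}(P)$ and $r_{\mathbb C}(P)+r_{\mathbb R}(P)\le 3d-1$. Let $S_{\mathbb C}\subset\mathbb P^m(\mathbb C)$ and $S_{\mathbb R}\subset\mathbb P^m(\mathbb R)$ be any sets evincing $r_{\mathbb C}(P)$ and $r_{\mathbb R}(P)$ respectively. Then at least one of the following holds. (a) There is a line $l\subset\mathbb P^m$ defined over $\mathbb R$ such that (i) $S_{\mathbb C}\setminus l=S_{\mathbb R}\setminus l$; (ii) there is a point $P_l\in\mathbb P^N(\mathbb R)$ with $P_l\in\langle\nu_d(S_{\mathbb C,l})\rangle\cap\langle\nu_d(S_{\mathbb R,l})\rangle$ such that $S_{\mathbb C,l}$ evinces $r_{\mathbb C}(P_l)$ and $S_{\mathbb R,l}$ evinces $r_{\mathbb R}(P_l)$; (iii) $\sharp(S_{\mathbb C,l}\cup S_{\mathbb R,l})\ge d+2$ and $\sharp(S_{\mathbb C,l})<\sharp(S_{\mathbb R,l})$. (b) There is a reduced (plane) conic $C\subset\mathbb P^m$ defined over $\mathbb R$ such that (i) $S_{\mathbb C}\setminus C=S_{\mathbb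 R}\setminus C$; (ii) there is a point $P_C\in\mathbb P^N(\mathbb R)$ with $P_C\in\langle\nu_d(S_{\mathbb C,C})\rangle\cap\langle\nu_d(S_{\mathbb R,C})\rangle$ such that $S_{\mathbb C,C}$ evinces $r_{\mathbb C}(P_C)$ and $S_{\mathbb R,C}$ evinces $r_{\mathbb R}(P_C)$; (iii) $\sharp(S_{\mathbb C,C}\cup S_{\mathbb R,C})\ge 2d+2$ and $\sharp(S_{\mathbb C,C})<\sharp(S_{\mathbb R,C})$; (iv) if $C$ is reducible, $C=l_1\cup l_2$ with lines $l_1,l_2$ and $l_1\cap l_2=\{Q\}$, then $\sharp((S_{\mathbb C}\cup S_{\mathbb R})\cap(l_i\setminus\{Q\}))\ge d+1$ for $i=1,2$. (c) $m\ge 3$ and there are two disjoint lines $l,r\subset\mathbb P^m$ defined over $\mathbb R$ such that, with $\Gamma=l\cup r$, (i) $S_{\mathbb C}\setminus\Gamma=S_{\mathbb R}\setminus\Gamma=:S_{\hat\Gamma}$; (ii) $\sharp(S_{\mathbb C,l}\cup S_{\mathbb R,l})\ge d+2$ and $\sharp(S_{\mathbb C,r}\cup S_{\mathbb R,r})\ge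 d+2$; (iii) $\langle\{P\}\cup\nu_d(S_{\hat\Gamma})\rangle\cap\langle\nu_d(\Gamma)\rangle$ is a single point $O_\Gamma\in\mathbb P^N(\mathbb R)$, $S_{\mathbb C,\Gamma}$ evinces $r_{\mathbb C}(O_\Gamma)$ and $S_{\mathbb R,\Gamma}$ evinces $r_{\mathbb R}(O_\Gamma)$; (iv) $\langle\{O_\Gamma\}\cup\nu_d(r)\rangle\cap\langle\nu_d(l)\rangle$ is a single point $O_l\in\mathbb P^N(\mathbb R)$ and $\langle\{O_\Gamma\}\cup\nu_d(l)\rangle\cap\langle\nu_d(r)\rangle$ is a single point $O_r\in\mathbb P^N(\mathbb R)$; $S_{\mathbb C,l}$ and $S_{\mathbb C,r}$ evince $r_{\mathbb C}(O_l)$ and $r_{\mathbb C}(O_r)$; $S_{\mathbb R,l}$ and $S_{\mathbb R,r}$ evince $r_{\mathbb R}(O_l)$ and $r_{\mathbb R}(O_r)$. -/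

import Mathlib

open scoped LinearAlgebra.Projectivization

noncomputable section

namespace VeroneseRank

/-- The vector space of homogeneous polynomials of degree `d` in `m + 1` variables over `K`. -/
abbrev Form (K : Type) [Field K] (m d : ℕ) : Type :=
  MvPolynomial.homogeneousSubmodule (Fin (m + 1)) K d

/-- The projective space `P^m(K)`. -/
abbrev PSpace (K : Type) [Field K] (m : ℕ) : Type := ℙ K (Fin (m + 1) → K)

/-- The projective space `P^N(K)`, `N = binom (m + d) d - 1`, of forms of degree `d` in `m + 1`
variables. -/
abbrev FormSpace (K : Type) [Field K] (m d : ℕ) : Type := ℙ K (Form K m d)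

section Field

variable {K : Type} [Field K] {m : ℕ}

/-- The linear form `∑ i, v i * X i`. -/
def linForm (v : Fin (m + 1) → K) : MvPolynomial (Fin (m + 1)) K :=
  ∑ i, MvPolynomial.C (v i) * MvPolynomial.X i

lemma linForm_isHomogeneous (v : Fin (m + 1) → K) : (linForm v).IsHomogeneous 1 := by
  refine MvPolynomial.IsHomogeneous.sum _ _ _ fun i _ => ?_
  simpa using (MvPolynomial.isHomogeneous_C _ (v i)).mul (MvPolynomial.isHomogeneous_X K i)

lemma linForm_smul (t : K) (v : Fin (m + 1) → K) :
    linForm (t • v) = MvPolynomial.C t * linForm v := by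
  simp [linForm, Finset.mul_sum, mul_assoc]

lemma linForm_ne_zero {v : Fin (m + 1) → K} (hv : v ≠ 0) : linForm v ≠ 0 := by
  obtain ⟨i, hi⟩ := Function.ne_iff.mp hv
  intro h
  apply hi
  have := congrArg (MvPolynomial.eval (Pi.single i (1 : K))) h
  simpa [linForm, Pi.single_apply] using this

/-- The form `L_v ^ d`, where `L_v` is the linear form with coefficient vector `v`. -/
def powForm (d : ℕ) (v : Fin (m + 1) → K) : Form K m d :=
  ⟨linForm v ^ d, by
    rw [MvPolynomial.mem_homogeneousSubmodule]
    simpa using (linForm_isHomogeneous v).pow d⟩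

lemma powForm_ne_zero (d : ℕ) {v : Fin (m + 1) → K} (hv : v ≠ 0) : powForm d v ≠ 0 := by
  intro h
  exact pow_ne_zero d (linForm_ne_zero hv) (congrArg Subtype.val h)

lemma powForm_smul (d : ℕ) (t : K) (v : Fin (m + 1) → K) :
    powForm d (t • v) = t ^ d • powForm d v := by
  apply Subtype.ext
  simp [powForm, linForm_smul, mul_pow, MvPolynomial.smul_eq_C_mul]

/-- The degree `d` Veronese map `[v] ↦ [L_v ^ d]`. -/
def veronese (d : ℕ) : PSpace K m → FormSpace K m d :=
  Projectivization.lift (fun v => Projectivization.mk K (powForm d v.1) (powForm_ne_zero d v.2))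
    (by
      intro a b t h
      refine (Projectivization.mk_eq_mk_iff' K _ _ _ _).mpr ⟨t ^ d, ?_⟩
      rw [h, powForm_smul])

/-- The linear span of the image of a set of points under the Veronese map. -/
def verSpan (d : ℕ) (S : Set (PSpace K m)) : Projectivization.Subspace K (Form K m d) :=
  Projectivization.Subspace.span (veronese d '' S)

/-- The symmetric rank over `K` of a point `P` of the projective space of forms over `K`: the least
cardinality of a finite set of points of `P^m(K)` whose Veronese image spans (over `K`) a linear
space through `P`. -/
def symRank {d : ℕ} (P : FormSpace K m d) : ℕ :=
  sInf {n : ℕ | ∃ S : Set (PSpace K m), S.Finite ∧ S.ncard = n ∧ P ∈ verSpan d S}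

/-- `S` evinces the symmetric rank of `P` over `K`. -/
def Evinces {d : ℕ} (S : Set (PSpace K m)) (P : FormSpace K m d) : Prop :=
  S.Finite ∧ P ∈ verSpan d S ∧ S.ncard = symRank P

end Field

section RealPoints

variable {m d : ℕ}

/-- The inclusion of `ℝ^(m+1)` in `ℂ^(m+1)`. -/
def vecToComplex : (Fin (m + 1) → ℝ) →ₛₗ[algebraMap ℝ ℂ] (Fin (m + 1) → ℂ) where
  toFun v := fun i => (v i : ℂ)
  map_add' v w := by ext i; simp
  map_smul' t v := by ext i; simp

lemma vecToComplex_injective :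
    Function.Injective (vecToComplex : (Fin (m + 1) → ℝ) →ₛₗ[algebraMap ℝ ℂ] _) := by
  intro v w h
  ext i
  exact Complex.ofReal_injective (congrFun h i)

/-- A real form, seen as a complex form. -/
def formToComplex : Form ℝ m d →ₛₗ[algebraMap ℝ ℂ] Form ℂ m d where
  toFun f := ⟨MvPolynomial.map (algebraMap ℝ ℂ) f.1, by
    rw [MvPolynomial.mem_homogeneousSubmodule]
    exact ((MvPolynomial.mem_homogeneousSubmodule d f.1).mp f.2).map _⟩
  map_add' f g := by apply Subtype.ext; simp
  map_smul' t f := by apply Subtype.ext; simp [MvPolynomial.smul_eq_C_mul]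

lemma formToComplex_injective :
    Function.Injective (formToComplex : Form ℝ m d →ₛₗ[algebraMap ℝ ℂ] _) := by
  intro f g h
  apply Subtype.ext
  exact MvPolynomial.map_injective _ (algebraMap ℝ ℂ).injective (congrArg Subtype.val h)

/-- The inclusion of `P^m(ℝ)` in `P^m(ℂ)`. -/
def toC : PSpace ℝ m → PSpace ℂ m :=
  Projectivization.map vecToComplex vecToComplex_injective

/-- The inclusion of `P^N(ℝ)` in `P^N(ℂ)`. -/
def formToC : FormSpace ℝ m d → FormSpace ℂ m d :=
  Projectivization.map formToComplex formToComplex_injective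

end RealPoints

section Curves

variable {m : ℕ}

/-- `Z ⊆ P^m(ℂ)` is cut out by homogeneous polynomials with real coefficients. -/
def DefinedOverReal (Z : Set (PSpace ℂ m)) : Prop :=
  ∃ F : Set (MvPolynomial (Fin (m + 1)) ℝ), (∀ f ∈ F, ∃ n : ℕ, f.IsHomogeneous n) ∧
    Z = {x | ∀ f ∈ F, MvPolynomial.aeval x.rep f = 0}

/-- `Z` is a line of `P^m(ℂ)`. -/
def IsLine (Z : Set (PSpace ℂ m)) : Prop :=
  ∃ W : Submodule ℂ (Fin (m + 1) → ℂ), Module.finrank ℂ W = 2 ∧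
    Z = (W.projectivization : Set (PSpace ℂ m))

/-- `Z` is a reduced conic of `P^m(ℂ)`: the zero locus, in a plane, of a quadratic form whose
restriction to the plane is neither zero nor the square of a linear form. -/
def IsReducedConic (Z : Set (PSpace ℂ m)) : Prop :=
  ∃ (W : Submodule ℂ (Fin (m + 1) → ℂ)) (q : QuadraticForm ℂ (Fin (m + 1) → ℂ)),
    Module.finrank ℂ W = 3 ∧
    (¬ ∃ L : (Fin (m + 1) → ℂ) →ₗ[ℂ] ℂ, ∀ w ∈ W, q w = L w ^ 2) ∧
    Z = {x | x ∈ W.projectivization ∧ q x.rep = 0}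

end Curves

section Cases

variable {m d : ℕ}

/-- The part of `SC` on `Z` evinces the complex rank, and the part of `SR` on `Z` evinces the real
rank, of the real point `Q` of `P^N`. -/
def EvincesBothOn (d : ℕ) (SC : Set (PSpace ℂ m)) (SR : Set (PSpace ℝ m)) (Z : Set (PSpace ℂ m))
    (Q : FormSpace ℝ m d) : Prop :=
  Evinces (SC ∩ Z) (formToC Q) ∧ Evinces (SR ∩ toC ⁻¹' Z) Q

/-- The two sets differ only on a real line. -/
def LineCase (d : ℕ) (SC : Set (PSpace ℂ m)) (SR : Set (PSpace ℝ m)) : Prop :=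
  ∃ l : Set (PSpace ℂ m), IsLine l ∧ DefinedOverReal l ∧
    SC \ l = (toC '' SR) \ l ∧
    (∃ Pl : FormSpace ℝ m d,
      formToC Pl ∈ verSpan d (SC ∩ l) ∧ formToC Pl ∈ verSpan d (toC '' SR ∩ l) ∧
      EvincesBothOn d SC SR l Pl) ∧
    d + 2 ≤ ((SC ∪ toC '' SR) ∩ l).ncard ∧
    (SC ∩ l).ncard < (toC '' SR ∩ l).ncard

/-- The two sets differ only on a real reduced conic. -/
def ConicCase (d : ℕ) (SC : Set (PSpace ℂ m)) (SR : Set (PSpace ℝ m)) : Prop :=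
  ∃ C : Set (PSpace ℂ m), IsReducedConic C ∧ DefinedOverReal C ∧
    SC \ C = (toC '' SR) \ C ∧
    (∃ PC : FormSpace ℝ m d,
      formToC PC ∈ verSpan d (SC ∩ C) ∧ formToC PC ∈ verSpan d (toC '' SR ∩ C) ∧
      EvincesBothOn d SC SR C PC) ∧
    2 * d + 2 ≤ ((SC ∪ toC '' SR) ∩ C).ncard ∧
    (SC ∩ C).ncard < (toC '' SR ∩ C).ncard ∧
    ∀ (l₁ l₂ : Set (PSpace ℂ m)) (Q : PSpace ℂ m), IsLine l₁ → IsLine l₂ →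
      C = l₁ ∪ l₂ → l₁ ∩ l₂ = {Q} →
      d + 1 ≤ ((SC ∪ toC '' SR) ∩ (l₁ \ {Q})).ncard ∧
      d + 1 ≤ ((SC ∪ toC '' SR) ∩ (l₂ \ {Q})).ncard

/-- The two sets differ only on the union of two disjoint real lines. -/
def TwoLinesCase (d : ℕ) (P : FormSpace ℝ m d) (SC : Set (PSpace ℂ m)) (SR : Set (PSpace ℝ m)) :
    Prop :=
  3 ≤ m ∧ ∃ l r : Set (PSpace ℂ m), IsLine l ∧ IsLine r ∧ DefinedOverReal l ∧ DefinedOverReal r ∧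
    Disjoint l r ∧
    SC \ (l ∪ r) = (toC '' SR) \ (l ∪ r) ∧
    d + 2 ≤ ((SC ∪ toC '' SR) ∩ l).ncard ∧
    d + 2 ≤ ((SC ∪ toC '' SR) ∩ r).ncard ∧
    ∃ O Ol Or : FormSpace ℝ m d,
      (Projectivization.Subspace.span ({formToC P} ∪ veronese d '' (SC \ (l ∪ r))) :
          Set (FormSpace ℂ m d)) ∩ verSpan d (l ∪ r) = {formToC O} ∧
      EvincesBothOn d SC SR (l ∪ r) O ∧
      (Projectivization.Subspace.span ({formToC O} ∪ veronese d '' r) :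
          Set (FormSpace ℂ m d)) ∩ verSpan d l = {formToC Ol} ∧
      EvincesBothOn d SC SR l Ol ∧
      (Projectivization.Subspace.span ({formToC O} ∪ veronese d '' l) :
          Set (FormSpace ℂ m d)) ∩ verSpan d r = {formToC Or} ∧
      EvincesBothOn d SC SR r Or

end Cases

end VeroneseRank

end

open VeroneseRank

/-!
Let `SC` and `SR` be minimal complex and real decompositions of the real form `P` into powers of
linear forms. Their difference is a linear relation between the powers `L_x ^ d`, with nonzero
coefficients exactly on a finite set `T` which contains the symmetric difference of `SC` and `SR`
and has at most `3 d - 1` points. Off any set `Z` containing `T` the two decompositions agree, and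
the two parts on `Z` are decompositions of the same real form. An exchange argument
(`IsMinimal.subset`) shows that these parts are again minimal. So everything rests on the position
of `T`.

By apolarity (`exists_apolar`) the relation says that `∑ c_x G(x) = 0` for all forms `G` of degree
`d`, hence `T` has the Cayley–Bacharach property in degree `d`: a form of degree `d` that vanishes
at all points of `T` but one vanishes on `T`. If `H` is a form of degree `e`, the points of `T` off
`H = 0` have this property in degree `d - e` (`CayleyBacharach.residual`). Induction with this
remark shows that at most `2 d + 1` such points are collinear (`CayleyBacharach.collinear`), and that
at most `3 d - 1` such points lie on a line, on two disjoint lines or on a plane conic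
(`CayleyBacharach.line_or_lines_or_conic`). The essential plane case is the one in which no three
points are collinear and there is no conic through all of them. Then residuation and dimension
counts put the points on a cubic and on a curve of degree `d - 1` without common component, against
Bézout's inequality (`card_le_of_isRelPrime`), itself a dimension count.

It remains to see that the curve is real. On a line that carries a relation, minimality gives at
least as many points of `SR` as of `SC`, hence two real points. A conic without lines contains five
real points and is determined by them (`conic_unique`), so it coincides with a real conic through
these points (`definedOverReal_conic`). For a pair of meeting lines the contraction of one line to
the common point shows that each line contains two real points
(`Decompositions.ncard_inter_le_add_one`). For two disjoint lines a projection splits the relation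
(`exists_verSub_projection`), and the few common points of the decompositions off the lines are
separated by forms that vanish on both lines.
-/

namespace VeroneseRank

open MvPolynomial
open scoped Classical

/-! ### Finite sets with the Cayley–Bacharach property -/

section CayleyBacharach

variable {K : Type} [Field K] {n : ℕ}

/-- The linear form attached to a linear functional on `K ^ n`. -/
noncomputable def dualPoly (f : Module.Dual K (Fin n → K)) : MvPolynomial (Fin n) K :=
  ∑ i, C (f (Pi.single i 1)) * X i

lemma dualPoly_isHomogeneous (f : Module.Dual K (Fin n → K)) : (dualPoly f).IsHomogeneous 1 :=
  IsHomogeneous.sum _ _ _ fun i _ => isHomogeneous_C_mul_X _ i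

@[simp]
lemma eval_dualPoly (f : Module.Dual K (Fin n → K)) (v : Fin n → K) :
    eval v (dualPoly f) = f v := by
  simp only [dualPoly, map_sum, map_mul, eval_C, eval_X]
  rw [LinearMap.pi_apply_eq_sum_univ f v]
  refine Finset.sum_congr rfl fun i _ => ?_
  rw [smul_eq_mul, mul_comm]
  congr
  ext j
  simp [Pi.single_apply, eq_comm]

/-- A finite set of vectors representing pairwise distinct points of projective space. -/
def PairwiseIndep (T : Finset (Fin n → K)) : Prop :=
  ∀ x ∈ T, x ≠ 0 ∧ ∀ y ∈ T, x ∈ Submodule.span K {y} → x = y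

lemma PairwiseIndep.mono {S T : Finset (Fin n → K)} (hT : PairwiseIndep T) (h : S ⊆ T) :
    PairwiseIndep S :=
  fun x hx => ⟨(hT x (h hx)).1, fun y hy => (hT x (h hx)).2 y (h hy)⟩

/-- The Cayley–Bacharach condition in degree `d`: a form of degree `d` that vanishes at all points
of `T` but one vanishes on `T`. -/
def CayleyBacharach (d : ℕ) (T : Finset (Fin n → K)) : Prop :=
  ∀ G : MvPolynomial (Fin n) K, G.IsHomogeneous d → ∀ x ∈ T,
    (∀ y ∈ T, y ≠ x → eval y G = 0) → eval x G = 0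

/-- The part of a Cayley–Bacharach set outside `Z` satisfies the condition in a lower degree, as
soon as forms of degree `e` vanishing on `Z` separate `Z` from the other points. -/
lemma CayleyBacharach.residual {d e : ℕ} {T : Finset (Fin n → K)} (hT : CayleyBacharach (d + e) T)
    (Z : (Fin n → K) → Prop)
    (hZ : ∀ x ∈ T, ¬ Z x → ∃ H : MvPolynomial (Fin n) K, H.IsHomogeneous e ∧
      (∀ y ∈ T, Z y → eval y H = 0) ∧ eval x H ≠ 0) :
    CayleyBacharach d (T.filter fun x => ¬ Z x) := by
  intro G hG x hx hv
  rw [Finset.mem_filter] at hx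
  obtain ⟨H, hH, hHZ, hHx⟩ := hZ x hx.1 hx.2
  have := hT (G * H) (hG.mul hH) x hx.1 fun y hy hyx => by
    by_cases hyZ : Z y
    · simp [hHZ y hy hyZ]
    · simp [hv y (Finset.mem_filter.2 ⟨hy, hyZ⟩) hyx]
  rw [map_mul] at this
  exact (mul_eq_zero.1 this).resolve_right hHx

lemma CayleyBacharach.residual_submodule {d : ℕ} {T : Finset (Fin n → K)}
    (hT : CayleyBacharach (d + 1) T) (W : Submodule K (Fin n → K)) :
    CayleyBacharach d (T.filter fun x => x ∉ W) := by
  refine hT.residual (· ∈ W) fun x _ hx => ?_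
  obtain ⟨f, hfx, hf⟩ := Submodule.exists_le_ker_of_notMem hx
  exact ⟨dualPoly f, dualPoly_isHomogeneous f, fun y _ hy => by simpa using hf hy, by simpa⟩

lemma CayleyBacharach.residual_poly {d e : ℕ} {T : Finset (Fin n → K)}
    (hT : CayleyBacharach (d + e) T) {F : MvPolynomial (Fin n) K} (hF : F.IsHomogeneous e) :
    CayleyBacharach d (T.filter fun x => ¬ eval x F = 0) :=
  hT.residual (fun x => eval x F = 0) fun _ _ hx => ⟨F, hF, fun _ _ hy => hy, hx⟩

/-- A point is separated from at most `d` others by a product of `d` linear forms. -/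
lemma exists_form_separating {d : ℕ} (S : Finset (Fin n → K)) (x : Fin n → K) (hx : x ≠ 0)
    (hS : ∀ y ∈ S, x ∉ Submodule.span K {y}) (hd : S.card ≤ d) :
    ∃ G : MvPolynomial (Fin n) K, G.IsHomogeneous d ∧ (∀ y ∈ S, eval y G = 0) ∧ eval x G ≠ 0 := by
  induction d generalizing S with
  | zero =>
    have : S = ∅ := by simpa using hd
    exact ⟨1, isHomogeneous_one _ _, by simp [this], by simp⟩
  | succ d ih =>
    have key : ∃ (S' : Finset (Fin n → K)) (y : Fin n → K), S'.card ≤ d ∧ S ⊆ insert y S' ∧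
        x ∉ Submodule.span K {y} ∧ S' ⊆ S := by
      rcases S.eq_empty_or_nonempty with rfl | ⟨y, hy⟩
      · exact ⟨∅, 0, by simp, by simp, by simpa using hx, by simp⟩
      · refine ⟨S.erase y, y, ?_, ?_, hS y hy, Finset.erase_subset _ _⟩
        · rw [Finset.card_erase_of_mem hy]; omega
        · rw [Finset.insert_erase hy]
    obtain ⟨S', y, hc, hsub, hxy, hS'⟩ := key
    obtain ⟨G, hG, hGS, hGx⟩ := ih S' (fun z hz => hS z (hS' hz)) hc
    obtain ⟨f, hfx, hf⟩ := Submodule.exists_le_ker_of_notMem hxy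
    refine ⟨G * dualPoly f, hG.mul (dualPoly_isHomogeneous f), fun z hz => ?_, ?_⟩
    · rcases Finset.mem_insert.1 (hsub hz) with rfl | h
      · have : f z = 0 := hf (Submodule.mem_span_singleton_self z)
        simp [this]
      · simp [hGS z h]
    · simpa using ⟨hGx, hfx⟩

lemma CayleyBacharach.card_ge {d : ℕ} {T : Finset (Fin n → K)} (hT : CayleyBacharach d T)
    (hi : PairwiseIndep T) (hne : T.Nonempty) : d + 2 ≤ T.card := by
  by_contra! h
  obtain ⟨x, hx⟩ := hne
  obtain ⟨G, hG, hGS, hGx⟩ := exists_form_separating (d := d) (T.erase x) x (hi x hx).1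
    (fun y hy hxy => (Finset.mem_erase.1 hy).1 ((hi x hx).2 y (Finset.mem_erase.1 hy).2 hxy).symm)
    (by rw [Finset.card_erase_of_mem hx]; omega)
  exact hGx (hT G hG x hx fun y hy hyx => hGS y (Finset.mem_erase.2 ⟨hyx, hy⟩))

lemma finrank_span_pair_le (x y : Fin n → K) :
    Module.finrank K (Submodule.span K ({x, y} : Set (Fin n → K))) ≤ 2 := by
  have := finrank_span_finset_le_card (R := K) ({x, y} : Finset (Fin n → K))
  rw [Finset.coe_insert, Finset.coe_singleton] at this
  exact this.trans Finset.card_le_two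

/-- A Cayley–Bacharach set of at most `2 d + 1` points is collinear. -/
theorem CayleyBacharach.collinear {d : ℕ} {T : Finset (Fin n → K)} (hT : CayleyBacharach d T)
    (hi : PairwiseIndep T) (hc : T.card ≤ 2 * d + 1) :
    ∃ W : Submodule K (Fin n → K), Module.finrank K W ≤ 2 ∧ ∀ x ∈ T, x ∈ W := by
  induction d generalizing T with
  | zero =>
    rcases T.eq_empty_or_nonempty with rfl | hne
    · exact ⟨⊥, by simp, by simp⟩
    · have := hT.card_ge hi hne
      omega
  | succ d ih =>
    by_contra! hno
    -- Every line through two points of `T` leaves at least `d + 2` points outside.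
    have step : ∀ x ∈ T, ∀ y ∈ T, x ≠ y → d + 2 ≤
        (T.filter fun z => z ∉ Submodule.span K ({x, y} : Set (Fin n → K))).card := by
      intro x hx y hy hxy
      obtain ⟨z, hz, hzW⟩ := hno _ (finrank_span_pair_le x y)
      exact (hT.residual_submodule _).card_ge (hi.mono (Finset.filter_subset _ _))
        ⟨z, Finset.mem_filter.2 ⟨hz, hzW⟩⟩
    have hne : T.Nonempty := by
      obtain ⟨z, hz, -⟩ := hno ⊥ (by simp)
      exact ⟨z, hz⟩
    have h2 : 1 < T.card := by have := hT.card_ge hi hne; omega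
    obtain ⟨x, hx, y, hy, hxy⟩ := Finset.one_lt_card.1 h2
    set L := Submodule.span K ({x, y} : Set (Fin n → K)) with hL
    have hxL : x ∈ L := Submodule.subset_span (by simp)
    have hyL : y ∈ L := Submodule.subset_span (by simp)
    have h3 : d + 2 ≤ (T.filter fun z => z ∉ L).card := step x hx y hy hxy
    have h4 : 2 ≤ (T.filter fun z => z ∈ L).card := by
      have : ({x, y} : Finset (Fin n → K)) ⊆ T.filter fun z => z ∈ L := by
        intro z hz
        rcases Finset.mem_insert.1 hz with rfl | h
        · exact Finset.mem_filter.2 ⟨hx, hxL⟩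
        · rw [Finset.mem_singleton.1 h]; exact Finset.mem_filter.2 ⟨hy, hyL⟩
      simpa [Finset.card_pair hxy] using Finset.card_le_card this
    have h5 := Finset.card_filter_add_card_filter_not (s := T) (fun z => z ∈ L)
    obtain ⟨W, hW, hTW⟩ := ih (hT.residual_submodule L) (hi.mono (Finset.filter_subset _ _))
      (by omega)
    obtain ⟨z, hz, hzW⟩ := hno W hW
    have h6 := (hT.residual_submodule W).card_ge (hi.mono (Finset.filter_subset _ _))
        ⟨z, Finset.mem_filter.2 ⟨hz, hzW⟩⟩
    have h7 : (T.filter fun z => z ∉ L).card ≤ (T.filter fun z => z ∈ W).card :=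
      Finset.card_le_card fun v hv => Finset.mem_filter.2 ⟨(Finset.mem_filter.1 hv).1, hTW v hv⟩
    have h8 := Finset.card_filter_add_card_filter_not (s := T) (fun z => z ∈ W)
    omega

end CayleyBacharach

/-! ### Dimension counts for ternary forms -/

section Dimension

variable {K : Type} [Field K] {n : ℕ}

instance homogeneousSubmodule_finite (d : ℕ) :
    Module.Finite K (homogeneousSubmodule (Fin n) K d) :=
  Module.Finite.iff_fg.2 (homogeneousSubmodule_fg (Fin n) K d)

lemma two_mul_finrank_ternary (d : ℕ) :
    2 * Module.finrank K (homogeneousSubmodule (Fin 3) K d) = (d + 2) * (d + 1) := by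
  have h1 : Module.finrank K (homogeneousSubmodule (Fin 3) K d) =
      ((Finset.univ : Finset (Fin 3)).finsuppAntidiag d).card := by
    have hset : {f : Fin 3 →₀ ℕ | f.degree = d} =
        ↑((Finset.univ : Finset (Fin 3)).finsuppAntidiag d) := by
      ext f
      simp [Finset.mem_finsuppAntidiag, Finsupp.degree_eq_sum]
    rw [homogeneousSubmodule_eq_finsupp_supported, hset]
    rw [(AddMonoidAlgebra.supportedEquivFinsupp _).finrank_eq, Module.finrank_finsupp_self]
    simp
  rw [h1, Finset.card_finsuppAntidiag_nat_eq_choose]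
  have h2 : (Finset.univ : Finset (Fin 3)).card + d - 1 = d + 2 := by simp; omega
  rw [h2, Nat.choose_symm_add, Nat.choose_two_right]
  have := Nat.even_mul_pred_self (d + 2)
  rw [Nat.mul_div_cancel' this.two_dvd]
  rfl

/-- Evaluation of forms of degree `d` at the points of `T`. -/
noncomputable def evalForms (d : ℕ) (T : Finset (Fin n → K)) :
    homogeneousSubmodule (Fin n) K d →ₗ[K] (T → K) :=
  LinearMap.pi fun x => (aeval (R := K) (x : Fin n → K)).toLinearMap.comp (Submodule.subtype _)

@[simp]
lemma evalForms_apply (d : ℕ) (T : Finset (Fin n → K)) (G : homogeneousSubmodule (Fin n) K d)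
    (x : T) : evalForms d T G x = eval (x : Fin n → K) (G : MvPolynomial (Fin n) K) := by
  simp [evalForms, aeval_eq_eval]

lemma mem_ker_evalForms {d : ℕ} {T : Finset (Fin n → K)} {G : homogeneousSubmodule (Fin n) K d} :
    G ∈ LinearMap.ker (evalForms d T) ↔ ∀ x ∈ T, eval x (G : MvPolynomial (Fin n) K) = 0 := by
  rw [LinearMap.mem_ker, funext_iff]
  simp

lemma finrank_le_card_add_finrank_ker (d : ℕ) (T : Finset (Fin n → K)) :
    Module.finrank K (homogeneousSubmodule (Fin n) K d) ≤
      T.card + Module.finrank K (LinearMap.ker (evalForms d T)) := by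
  rw [← (evalForms d T).finrank_range_add_finrank_ker]
  gcongr
  simpa using Submodule.finrank_le (LinearMap.range (evalForms d T))

/-- Points that are separated from one another by forms of degree `d` impose independent conditions
on these forms. -/
lemma range_evalForms_eq_top {d : ℕ} {T : Finset (Fin n → K)}
    (h : ∀ x ∈ T, ∃ G : MvPolynomial (Fin n) K, G.IsHomogeneous d ∧
      (∀ y ∈ T, y ≠ x → eval y G = 0) ∧ eval x G ≠ 0) :
    LinearMap.range (evalForms d T) = ⊤ := by
  rw [eq_top_iff, ← (Pi.basisFun K T).span_eq, Submodule.span_le]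
  rintro _ ⟨x, rfl⟩
  obtain ⟨G, hG, hG0, hGx⟩ := h x x.2
  refine ⟨(eval (x : Fin n → K) G)⁻¹ • ⟨G, hG⟩, ?_⟩
  ext y
  by_cases hyx : y = x
  · subst hyx; simp [hGx]
  · simp [hyx, hG0 y y.2 (fun h => hyx (Subtype.ext h))]

lemma exists_form_ne_zero {d : ℕ} {T : Finset (Fin 3 → K)} (h : 2 * T.card < (d + 2) * (d + 1)) :
    ∃ F : MvPolynomial (Fin 3) K, F.IsHomogeneous d ∧ F ≠ 0 ∧ ∀ x ∈ T, eval x F = 0 := by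
  have h1 := finrank_le_card_add_finrank_ker d T
  have h2 := two_mul_finrank_ternary (K := K) d
  have h3 : LinearMap.ker (evalForms d T) ≠ ⊥ := by
    intro h0
    rw [h0, finrank_bot] at h1
    omega
  obtain ⟨G, hG, hG0⟩ := Submodule.exists_mem_ne_zero_of_ne_bot h3
  exact ⟨G, G.2, fun h => hG0 (Subtype.ext h), mem_ker_evalForms.1 hG⟩

/-- Multiplication by a form of degree `a`, on forms of degree `e`. -/
noncomputable def mulForm {a e N : ℕ} {F : MvPolynomial (Fin n) K} (hF : F.IsHomogeneous a)
    (h : e + a = N) : homogeneousSubmodule (Fin n) K e →ₗ[K] homogeneousSubmodule (Fin n) K N :=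
  (LinearMap.mulRight K F).restrict fun p hp => by
    subst h
    exact IsHomogeneous.mul hp hF

@[simp]
lemma coe_mulForm {a e N : ℕ} {F : MvPolynomial (Fin n) K} (hF : F.IsHomogeneous a)
    (h : e + a = N) (p : homogeneousSubmodule (Fin n) K e) :
    (mulForm hF h p : MvPolynomial (Fin n) K) = p * F := rfl

/-- Few points lie on a form of degree `e + a` that is not a multiple of a given form `F` of
degree `a`. -/
lemma exists_form_not_dvd {a e : ℕ} {F : MvPolynomial (Fin 3) K} (hF : F.IsHomogeneous a)
    {T : Finset (Fin 3 → K)}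
    (h : 2 * T.card + (e + 2) * (e + 1) < (e + a + 2) * (e + a + 1)) :
    ∃ G : MvPolynomial (Fin 3) K, G.IsHomogeneous (e + a) ∧ (∀ x ∈ T, eval x G = 0) ∧
      ∀ p : MvPolynomial (Fin 3) K, p.IsHomogeneous e → G ≠ p * F := by
  by_contra! hno
  have h1 := finrank_le_card_add_finrank_ker (K := K) (e + a) T
  have h2 := two_mul_finrank_ternary (K := K) (e + a)
  have h3 := two_mul_finrank_ternary (K := K) e
  have h4 : LinearMap.ker (evalForms (e + a) T) ≤
      LinearMap.range (mulForm hF (rfl : e + a = _)) := by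
    intro G hG
    obtain ⟨p, hp, hGp⟩ := hno G G.2 (mem_ker_evalForms.1 hG)
    exact ⟨⟨p, hp⟩, Subtype.ext hGp.symm⟩
  have h5 := Submodule.finrank_mono h4
  have h6 := LinearMap.finrank_range_le (mulForm hF (rfl : e + a = _))
  omega

end Dimension

/-! ### Bézout's inequality in the plane -/

section Bezout

variable {K : Type} [Field K]

/-- The substitution `X i ↦ t X i`. Its coefficients in `t` are the homogeneous components. -/
noncomputable def gradingHom (σ : Type) :
    MvPolynomial σ K →ₐ[K] Polynomial (MvPolynomial σ K) :=
  aeval fun i => Polynomial.C (X i) * Polynomial.X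

lemma gradingHom_monomial {σ : Type} (s : σ →₀ ℕ) (r : K) :
    gradingHom σ (monomial s r) = Polynomial.C (monomial s r) * Polynomial.X ^ s.degree := by
  rw [gradingHom, aeval_monomial, monomial_eq, Finsupp.prod, Finsupp.prod, Finsupp.degree_apply]
  simp only [mul_pow, Finset.prod_mul_distrib, Finset.prod_pow_eq_pow_sum, map_mul, map_prod,
    map_pow, mul_assoc]
  rfl

lemma coeff_gradingHom {σ : Type} (A : MvPolynomial σ K) (i : ℕ) :
    (gradingHom σ A).coeff i = homogeneousComponent i A := by
  induction A using MvPolynomial.induction_on' with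
  | monomial s r =>
    rw [gradingHom_monomial, Polynomial.coeff_C_mul, Polynomial.coeff_X_pow]
    split_ifs with h
    · rw [mul_one, homogeneousComponent_of_mem (isHomogeneous_monomial r rfl)]
      simp [h]
    · rw [mul_zero, homogeneousComponent_of_mem (isHomogeneous_monomial r rfl), if_neg h]
  | add p q hp hq => simp [hp, hq]

lemma gradingHom_of_isHomogeneous {σ : Type} {A : MvPolynomial σ K} {a : ℕ}
    (hA : A.IsHomogeneous a) : gradingHom σ A = Polynomial.C A * Polynomial.X ^ a := by
  ext1 i
  rw [coeff_gradingHom, Polynomial.coeff_C_mul, Polynomial.coeff_X_pow,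
    homogeneousComponent_of_mem hA]
  split_ifs <;> simp_all

/-- A factor of a nonzero form is a form. -/
lemma exists_isHomogeneous_of_mul {σ : Type} {A B : MvPolynomial σ K} {N : ℕ}
    (h : (A * B).IsHomogeneous N) (h0 : A * B ≠ 0) :
    ∃ a b, a + b = N ∧ A.IsHomogeneous a ∧ B.IsHomogeneous b := by
  have hA0 : A ≠ 0 := left_ne_zero_of_mul h0
  have hB0 : B ≠ 0 := right_ne_zero_of_mul h0
  have hinj : ∀ C : MvPolynomial σ K, C ≠ 0 → gradingHom σ C ≠ 0 := by
    intro C hC hz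
    apply hC
    rw [← sum_homogeneousComponent C]
    exact Finset.sum_eq_zero fun i _ => by rw [← coeff_gradingHom, hz, Polynomial.coeff_zero]
  have key := gradingHom_of_isHomogeneous h
  rw [map_mul] at key
  have h1 : (gradingHom σ A).natDegree + (gradingHom σ B).natDegree = N := by
    rw [← Polynomial.natDegree_mul (hinj A hA0) (hinj B hB0), key,
      Polynomial.natDegree_C_mul_X_pow _ _ h0]
  have h2 : (gradingHom σ A).natTrailingDegree + (gradingHom σ B).natTrailingDegree = N := by
    rw [← Polynomial.natTrailingDegree_mul (hinj A hA0) (hinj B hB0), key,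
      Polynomial.C_mul_X_pow_eq_monomial, Polynomial.natTrailingDegree_monomial h0]
  have h3 := Polynomial.natTrailingDegree_le_natDegree (gradingHom σ A)
  have h4 := Polynomial.natTrailingDegree_le_natDegree (gradingHom σ B)
  have hom : ∀ C : MvPolynomial σ K,
      (gradingHom σ C).natTrailingDegree = (gradingHom σ C).natDegree →
      C.IsHomogeneous (gradingHom σ C).natDegree := by
    intro C hC
    have : C = homogeneousComponent (gradingHom σ C).natDegree C := by
      conv_lhs => rw [← sum_homogeneousComponent C]
      rw [Finset.sum_eq_single (gradingHom σ C).natDegree]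
      · intro i _ hi
        rw [← coeff_gradingHom]
        rcases lt_or_gt_of_ne hi with hlt | hgt
        · exact Polynomial.coeff_eq_zero_of_lt_natTrailingDegree (by omega)
        · exact Polynomial.coeff_eq_zero_of_natDegree_lt hgt
      · intro hi
        refine homogeneousComponent_eq_zero _ _ ?_
        simpa using hi
    have h5 := homogeneousComponent_isHomogeneous (gradingHom σ C).natDegree C
    rwa [← this] at h5
  exact ⟨_, _, h1, hom A (by omega), hom B (by omega)⟩

/-- Bézout's inequality for common zeros of two coprime ternary forms. -/
theorem card_le_of_isRelPrime {a b : ℕ} {F G : MvPolynomial (Fin 3) K} (hF : F.IsHomogeneous a)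
    (hG : G.IsHomogeneous b) (hFG : IsRelPrime F G) (hF0 : F ≠ 0) {T : Finset (Fin 3 → K)}
    (hi : PairwiseIndep T) (hTF : ∀ x ∈ T, eval x F = 0) (hTG : ∀ x ∈ T, eval x G = 0) :
    T.card ≤ a * b := by
  set t := T.card with ht
  have hsurj : LinearMap.range (evalForms (a + b + t) T) = ⊤ := by
    refine range_evalForms_eq_top fun x hx => ?_
    obtain ⟨H, hH, hH0, hHx⟩ := exists_form_separating (d := a + b + t) (T.erase x) x (hi x hx).1
      (fun y hy hxy => (Finset.mem_erase.1 hy).1 ((hi x hx).2 y (Finset.mem_erase.1 hy).2 hxy).symm)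
      (by rw [Finset.card_erase_of_mem hx]; omega)
    exact ⟨H, hH, fun y hy hyx => hH0 y (Finset.mem_erase.2 ⟨hyx, hy⟩), hHx⟩
  let ψ := (mulForm hF (by omega : (b + t) + a = a + b + t)).coprod
    (mulForm hG (by omega : (a + t) + b = a + b + t))
  let χ := (mulForm hG (by omega : t + b = b + t)).prod (-mulForm hF (by omega : t + a = a + t))
  have hψ : LinearMap.range ψ ≤ LinearMap.ker (evalForms (a + b + t) T) := by
    rintro _ ⟨⟨p, q⟩, rfl⟩
    rw [mem_ker_evalForms]
    intro x hx
    simp [ψ, hTF x hx, hTG x hx]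
  have hχ : LinearMap.ker ψ ≤ LinearMap.range χ := by
    rintro ⟨p, q⟩ hpq
    have hpq' : (p : MvPolynomial (Fin 3) K) * F + q * G = 0 := congrArg Subtype.val hpq
    have hdvd : F ∣ q * G := ⟨-p, by linear_combination hpq'⟩
    obtain ⟨h, hq⟩ := hFG.dvd_of_dvd_mul_right hdvd
    have hh : h.IsHomogeneous t := by
      by_cases h0 : h = 0
      · rw [h0]; exact isHomogeneous_zero (Fin 3) K t
      · have hne : F * h ≠ 0 := mul_ne_zero hF0 h0
        have hom : (F * h).IsHomogeneous (a + t) := hq ▸ q.2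
        obtain ⟨a', t', hat, hF', hh⟩ := exists_isHomogeneous_of_mul hom hne
        have := hF'.inj_right hF hF0
        rwa [show t = t' by omega]
    have hp : (p : MvPolynomial (Fin 3) K) = -h * G := by
      apply mul_right_cancel₀ hF0
      rw [hq] at hpq'
      linear_combination hpq'
    refine ⟨-⟨h, hh⟩, Prod.ext (Subtype.ext ?_) (Subtype.ext ?_)⟩
    · simp [χ, hp]
    · simp [χ, hq, mul_comm]
  have e1 := (evalForms (a + b + t) T).finrank_range_add_finrank_ker
  rw [hsurj, finrank_top] at e1
  have e2 := ψ.finrank_range_add_finrank_ker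
  rw [Module.finrank_prod] at e2
  have e3 := Submodule.finrank_mono hψ
  have e4 := (Submodule.finrank_mono hχ).trans (LinearMap.finrank_range_le χ)
  have e5 : Module.finrank K (T → K) = t := by simp [ht]
  have d1 := two_mul_finrank_ternary (K := K) (a + b + t)
  have d2 := two_mul_finrank_ternary (K := K) (b + t)
  have d3 := two_mul_finrank_ternary (K := K) (a + t)
  have d4 := two_mul_finrank_ternary (K := K) t
  nlinarith

end Bezout

/-! ### Plane Cayley–Bacharach sets lie on conics -/

section Plane

variable {K : Type} [Field K] {n : ℕ}

lemma exists_eq_dualPoly {F : MvPolynomial (Fin n) K} (hF : F.IsHomogeneous 1) :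
    ∃ f : Module.Dual K (Fin n → K), F = dualPoly f := by
  have : F ∈ Submodule.span K (Set.range (X : Fin n → MvPolynomial (Fin n) K)) := by
    rwa [← homogeneousSubmodule_one_eq_span_X]
  induction this using Submodule.span_induction with
  | mem x hx =>
    obtain ⟨i, rfl⟩ := hx
    refine ⟨LinearMap.proj i, ?_⟩
    simp [dualPoly, Pi.single_apply]
  | zero => exact ⟨0, by simp [dualPoly]⟩
  | add x y hx hy h1 h2 =>
    have hx' : x.IsHomogeneous 1 := by
      rw [← mem_homogeneousSubmodule, homogeneousSubmodule_one_eq_span_X]; exact hx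
    have hy' : y.IsHomogeneous 1 := by
      rw [← mem_homogeneousSubmodule, homogeneousSubmodule_one_eq_span_X]; exact hy
    obtain ⟨f, rfl⟩ := h1 hx'
    obtain ⟨g, rfl⟩ := h2 hy'
    exact ⟨f + g, by simp [dualPoly, add_mul, Finset.sum_add_distrib]⟩
  | smul a x hx h1 =>
    have hx' : x.IsHomogeneous 1 := by
      rw [← mem_homogeneousSubmodule, homogeneousSubmodule_one_eq_span_X]; exact hx
    obtain ⟨f, rfl⟩ := h1 hx'
    exact ⟨a • f, by simp [dualPoly, Finset.smul_sum, smul_eq_C_mul, mul_assoc]⟩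

/-- In the plane, a subspace of dimension at most two lies on a line. -/
lemma exists_linear_form {W : Submodule K (Fin 3 → K)} (hW : Module.finrank K W ≤ 2) :
    ∃ F : MvPolynomial (Fin 3) K, F.IsHomogeneous 1 ∧ F ≠ 0 ∧ ∀ x ∈ W, eval x F = 0 := by
  have hlt : W < ⊤ := by
    refine lt_top_iff_ne_top.2 fun h => ?_
    rw [h, finrank_top] at hW
    simp at hW
  obtain ⟨f, hf0, hf⟩ := Submodule.exists_le_ker_of_lt_top W hlt
  refine ⟨dualPoly f, dualPoly_isHomogeneous f, fun h => hf0 ?_, fun x hx => by simpa using hf hx⟩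
  refine LinearMap.ext fun v => ?_
  simpa using congrArg (eval v) h

lemma exists_submodule_of_linear_form {F : MvPolynomial (Fin 3) K} (hF : F.IsHomogeneous 1)
    (hF0 : F ≠ 0) :
    ∃ W : Submodule K (Fin 3 → K), Module.finrank K W ≤ 2 ∧ ∀ x, eval x F = 0 → x ∈ W := by
  obtain ⟨f, rfl⟩ := exists_eq_dualPoly hF
  refine ⟨LinearMap.ker f, ?_, fun x hx => by simpa using hx⟩
  have hf : f ≠ 0 := by
    rintro rfl
    simp [dualPoly] at hF0
  have h1 := Module.Dual.finrank_ker_add_one_of_ne_zero hf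
  simp at h1
  omega

/-- No three of the points are collinear. -/
def NoThreeCollinear (T : Finset (Fin n → K)) : Prop :=
  ∀ W : Submodule K (Fin n → K), Module.finrank K W ≤ 2 → (T.filter fun x => x ∈ W).card ≤ 2

lemma NoThreeCollinear.mono {S T : Finset (Fin n → K)} (hT : NoThreeCollinear T) (h : S ⊆ T) :
    NoThreeCollinear S :=
  fun W hW => (Finset.card_le_card (Finset.filter_subset_filter _ h)).trans (hT W hW)

lemma CayleyBacharach.card_ge_of_noThreeCollinear {d : ℕ} {T : Finset (Fin n → K)}
    (hT : CayleyBacharach d T) (hi : PairwiseIndep T) (hcol : NoThreeCollinear T) (hd : 1 ≤ d)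
    (hne : T.Nonempty) : 2 * d + 2 ≤ T.card := by
  by_contra! h
  obtain ⟨W, hW, hTW⟩ := hT.collinear hi (by omega)
  have h1 := hcol W hW
  rw [Finset.filter_true_of_mem hTW] at h1
  linarith [hT.card_ge hi hne]

/-- If a line contains at least `d` of at most `3 d - 1` points with the Cayley–Bacharach property
in degree `d`, the other points are collinear. -/
lemma CayleyBacharach.exists_two_lines {d : ℕ} {T : Finset (Fin n → K)} (hT : CayleyBacharach d T)
    (hi : PairwiseIndep T) (hc : T.card + 1 ≤ 3 * d) {W : Submodule K (Fin n → K)}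
    (hd : d ≤ (T.filter fun x => x ∈ W).card) :
    ∃ W' : Submodule K (Fin n → K), Module.finrank K W' ≤ 2 ∧ ∀ x ∈ T, x ∉ W → x ∈ W' := by
  obtain ⟨e, rfl⟩ : ∃ e, d = e + 1 := ⟨d - 1, by omega⟩
  have h1 := Finset.card_filter_add_card_filter_not (s := T) (fun z => z ∈ W)
  obtain ⟨W', hW', h⟩ := (hT.residual_submodule W).collinear (hi.mono (Finset.filter_subset _ _))
    (by omega)
  exact ⟨W', hW', fun x hx hxW => h x (Finset.mem_filter.2 ⟨hx, hxW⟩)⟩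

/-- The inductive step of `CayleyBacharach.exists_conic` when no three points are collinear. If
there is no conic through `T`, then `T` lies on a cubic and on a curve of degree `d - 1` without common
component, against Bézout. -/
lemma CayleyBacharach.exists_conic_of_noThreeCollinear {d : ℕ} {T : Finset (Fin 3 → K)}
    (IH : ∀ e < d, ∀ S : Finset (Fin 3 → K), CayleyBacharach e S → PairwiseIndep S →
      S.card + 1 ≤ 3 * e →
      ∃ F : MvPolynomial (Fin 3) K, F.IsHomogeneous 2 ∧ F ≠ 0 ∧ ∀ x ∈ S, eval x F = 0)
    (hT : CayleyBacharach d T) (hi : PairwiseIndep T) (hc : T.card + 1 ≤ 3 * d)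
    (hcol : NoThreeCollinear T) :
    ∃ F : MvPolynomial (Fin 3) K, F.IsHomogeneous 2 ∧ F ≠ 0 ∧ ∀ x ∈ T, eval x F = 0 := by
  by_cases h5 : T.card ≤ 5
  · exact exists_form_ne_zero (by omega)
  obtain ⟨e, rfl⟩ : ∃ e, d = e + 3 := ⟨d - 3, by omega⟩
  have split : ∀ F : MvPolynomial (Fin 3) K, (T.filter fun x => eval x F = 0).card +
      (T.filter fun x => ¬ eval x F = 0).card = T.card :=
    fun F => Finset.card_filter_add_card_filter_not _
  -- the residual of `T` with respect to a form, when it is not empty, is large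
  have large : ∀ (F : MvPolynomial (Fin 3) K) (k l : ℕ), F.IsHomogeneous l → k + l = e + 3 →
      1 ≤ k → ¬ (∀ x ∈ T, eval x F = 0) →
      2 * k + 2 ≤ (T.filter fun x => ¬ eval x F = 0).card := by
    intro F k l hF hkl hk hne
    push Not at hne
    obtain ⟨x, hx, hxF⟩ := hne
    rw [← hkl] at hT
    exact (hT.residual_poly hF).card_ge_of_noThreeCollinear (hi.mono (Finset.filter_subset _ _))
      (hcol.mono (Finset.filter_subset _ _)) hk ⟨x, Finset.mem_filter.2 ⟨hx, hxF⟩⟩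
  have resIH : ∀ (F : MvPolynomial (Fin 3) K) (k l : ℕ), F.IsHomogeneous l → k + l = e + 3 →
      1 ≤ l → (T.filter fun x => ¬ eval x F = 0).card + 1 ≤ 3 * k →
      ∃ F' : MvPolynomial (Fin 3) K, F'.IsHomogeneous 2 ∧ F' ≠ 0 ∧
        ∀ x ∈ T, eval x F ≠ 0 → eval x F' = 0 := by
    intro F k l hF hkl hl hcard
    rw [← hkl] at hT
    obtain ⟨F', h1, h2, h3⟩ := IH k (by omega) _ (hT.residual_poly hF)
      (hi.mono (Finset.filter_subset _ _)) hcard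
    exact ⟨F', h1, h2, fun x hx hxF => h3 x (Finset.mem_filter.2 ⟨hx, hxF⟩)⟩
  have le_of_cover : ∀ F F' : MvPolynomial (Fin 3) K,
      (∀ x ∈ T, eval x F ≠ 0 → eval x F' = 0) →
      (T.filter fun x => ¬ eval x F = 0).card ≤ (T.filter fun x => eval x F' = 0).card := by
    intro F F' h
    refine Finset.card_le_card fun x hx => ?_
    rw [Finset.mem_filter] at hx ⊢
    exact ⟨hx.1, h x hx.1 hx.2⟩
  have line_le : ∀ F : MvPolynomial (Fin 3) K, F.IsHomogeneous 1 → F ≠ 0 →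
      (T.filter fun x => eval x F = 0).card ≤ 2 := by
    intro F hF hF0
    obtain ⟨W, hW, h⟩ := exists_submodule_of_linear_form hF hF0
    refine (Finset.card_le_card fun x hx => ?_).trans (hcol W hW)
    rw [Finset.mem_filter] at hx ⊢
    exact ⟨hx.1, h x hx.2⟩
  have subset_ge : ∀ (F : MvPolynomial (Fin 3) K) (U : Finset (Fin 3 → K)), U ⊆ T →
      (∀ x ∈ U, eval x F = 0) → U.card ≤ (T.filter fun x => eval x F = 0).card := by
    intro F U hU hUF
    exact Finset.card_le_card fun x hx => Finset.mem_filter.2 ⟨hU hx, hUF x hx⟩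
  by_contra hno
  have hno' : ∀ F : MvPolynomial (Fin 3) K, F.IsHomogeneous 2 → F ≠ 0 →
      ¬ ∀ x ∈ T, eval x F = 0 := fun F h1 h2 h3 => hno ⟨F, h1, h2, h3⟩
  have hcard : T.card = 3 * e + 8 := by
    by_contra hlt
    obtain ⟨x, hx, y, hy, hxy⟩ := Finset.one_lt_card.1 (by omega : 1 < T.card)
    obtain ⟨ℓ, hℓ, hℓ0, hℓW⟩ := exists_linear_form (finrank_span_pair_le x y)
    have h2 := subset_ge ℓ {x, y} (by grind) (fun z hz => hℓW z (Submodule.subset_span (by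
      simpa using hz)))
    rw [Finset.card_pair hxy] at h2
    have h3 := split ℓ
    obtain ⟨F, hF, hF0, hFT⟩ := resIH ℓ (e + 2) 1 hℓ rfl le_rfl (by omega)
    have h4 := large F (e + 1) 2 hF rfl (by omega) (hno' F hF hF0)
    have h5 := le_of_cover F ℓ (fun x hx h => by_contra fun h' => h (hFT x hx h'))
    have h6 := line_le ℓ hℓ hℓ0
    omega
  have conic_le : ∀ F : MvPolynomial (Fin 3) K, F.IsHomogeneous 2 → F ≠ 0 →
      (T.filter fun x => eval x F = 0).card ≤ 5 := by
    intro F hF hF0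
    by_contra! h6
    have h1 := split F
    have h2 := large F (e + 1) 2 hF rfl (by omega) (hno' F hF hF0)
    obtain ⟨F', hF', hF'0, hcov⟩ := resIH F (e + 1) 2 hF rfl (by omega) (by omega)
    have h3 := large F' (e + 1) 2 hF' rfl (by omega) (hno' F' hF' hF'0)
    have h4 := le_of_cover F F' hcov
    have h5 := split F'
    omega
  obtain _ | k := e
  · obtain ⟨U, hUT, hU⟩ := Finset.exists_subset_card_eq (by omega : 5 ≤ T.card)
    obtain ⟨F, hF, hF0, hFU⟩ := exists_form_ne_zero (d := 2) (T := U) (by omega)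
    have h1 := subset_ge F U hUT hFU
    have h2 := split F
    have h3 := large F 1 2 hF rfl le_rfl (hno' F hF hF0)
    omega
  obtain ⟨U, hUT, hU⟩ := Finset.exists_subset_card_eq (by omega : 9 ≤ T.card)
  obtain ⟨F, hF, hF0, hFU⟩ := exists_form_ne_zero (d := 3) (T := U) (by omega)
  have hTF : ∀ x ∈ T, eval x F = 0 := by
    by_contra hne
    have h1 := subset_ge F U hUT hFU
    have h2 := split F
    have h3 := large F (k + 1) 3 hF rfl (by omega) hne
    obtain ⟨F', hF', hF'0, hcov⟩ := resIH F (k + 1) 3 hF rfl (by omega) (by omega)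
    have h4 := le_of_cover F F' hcov
    have h5 := conic_le F' hF' hF'0
    omega
  obtain ⟨V, hVT, hV⟩ := Finset.exists_subset_card_eq (by omega : 3 * k + 8 ≤ T.card)
  obtain ⟨G, hG, hGV, hGF⟩ := exists_form_not_dvd (e := k) hF (T := V) (by rw [hV]; nlinarith)
  have hTG : ∀ x ∈ T, eval x G = 0 := by
    by_contra hne
    have h1 := subset_ge G V hVT hGV
    have h2 := split G
    have h3 := large G 1 (k + 3) hG (by omega) le_rfl hne
    omega
  have not_lc : ∀ A B : MvPolynomial (Fin 3) K, A.IsHomogeneous 1 → B.IsHomogeneous 2 →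
      A * B ≠ 0 → ¬ ∀ x ∈ T, eval x (A * B) = 0 := by
    intro A B hA hB h0 hAB
    have h1 := line_le A hA (left_ne_zero_of_mul h0)
    have h2 := conic_le B hB (right_ne_zero_of_mul h0)
    have h3 := split A
    have h4 := le_of_cover A B fun x hx hxA => by
      have := hAB x hx
      rw [map_mul] at this
      exact (mul_eq_zero.1 this).resolve_left hxA
    omega
  have isUnit_of_deg0 : ∀ A : MvPolynomial (Fin 3) K, A.IsHomogeneous 0 → A ≠ 0 →
      ∃ c : K, c ≠ 0 ∧ A = C c := by
    intro A hA hA0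
    have : A = C (coeff 0 A) := totalDegree_eq_zero_iff_eq_C.1 (hA.totalDegree hA0)
    refine ⟨coeff 0 A, fun h => hA0 ?_, this⟩
    rw [this, h, C_0]
  have hrel : IsRelPrime F G := by
    rintro H ⟨H', hFH⟩ ⟨q, hGH⟩
    have hne : H * H' ≠ 0 := hFH ▸ hF0
    obtain ⟨a, b, hab, hHa, hHb⟩ := exists_isHomogeneous_of_mul (hFH ▸ hF) hne
    have ha : a ≤ 3 := by omega
    interval_cases a
    · obtain ⟨c, hc, rfl⟩ := isUnit_of_deg0 H hHa (left_ne_zero_of_mul hne)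
      exact (Ne.isUnit hc).map C
    · obtain rfl : b = 2 := by omega
      exact absurd (hFH ▸ hTF) (not_lc H H' hHa hHb hne)
    · obtain rfl : b = 1 := by omega
      rw [mul_comm] at hFH hne
      exact absurd (hFH ▸ hTF) (not_lc H' H hHb hHa hne)
    · obtain rfl : b = 0 := by omega
      obtain ⟨c, hc, rfl⟩ := isUnit_of_deg0 H' hHb (right_ne_zero_of_mul hne)
      have hHF : H = C c⁻¹ * F := by
        rw [hFH, mul_comm H, ← mul_assoc, ← C_mul, inv_mul_cancel₀ hc, C_1, one_mul]
      by_cases hG0 : G = 0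
      · exact absurd (by simp [hG0]) (hGF 0 (isHomogeneous_zero (Fin 3) K k))
      · obtain ⟨a', b', hab', hH', hq⟩ := exists_isHomogeneous_of_mul (hGH ▸ hG) (hGH ▸ hG0)
        have := hH'.inj_right hHa (left_ne_zero_of_mul hne)
        obtain rfl : b' = k := by omega
        refine absurd ?_ (hGF (C c⁻¹ * q) (hq.C_mul _))
        rw [hGH, hHF]
        ring
  have := card_le_of_isRelPrime hF hG hrel hF0 hi hTF hTG
  omega

/-- A plane Cayley–Bacharach set for degree `d` of at most `3 d - 1` points lies on a conic. -/
theorem CayleyBacharach.exists_conic {d : ℕ} {T : Finset (Fin 3 → K)} (hT : CayleyBacharach d T)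
    (hi : PairwiseIndep T) (hc : T.card + 1 ≤ 3 * d) :
    ∃ F : MvPolynomial (Fin 3) K, F.IsHomogeneous 2 ∧ F ≠ 0 ∧ ∀ x ∈ T, eval x F = 0 := by
  induction d using Nat.strong_induction_on generalizing T with
  | _ d IH =>
  by_cases hline : ∃ W : Submodule K (Fin 3 → K), Module.finrank K W ≤ 2 ∧
      d ≤ (T.filter fun x => x ∈ W).card
  · obtain ⟨W, hW, hdW⟩ := hline
    obtain ⟨W', hW', h⟩ := hT.exists_two_lines hi hc hdW
    obtain ⟨F, hF, hF0, hFW⟩ := exists_linear_form hW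
    obtain ⟨F', hF', hF'0, hFW'⟩ := exists_linear_form hW'
    refine ⟨F * F', hF.mul hF', mul_ne_zero hF0 hF'0, fun x hx => ?_⟩
    by_cases hxW : x ∈ W
    · simp [hFW x hxW]
    · simp [hFW' x (h x hx hxW)]
  push Not at hline
  by_cases hcol : NoThreeCollinear T
  · exact hT.exists_conic_of_noThreeCollinear (fun e he S h1 h2 h3 => IH e he h1 h2 h3) hi hc hcol
  -- A line with at least three points of `T`: the other points lie on a conic, and a point of the
  -- line off this conic would force `d` points of `T` onto the line.
  unfold NoThreeCollinear at hcol
  push Not at hcol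
  obtain ⟨W, hW, h3⟩ := hcol
  have hlt := hline W hW
  obtain ⟨e, rfl⟩ : ∃ e, d = e + 2 := ⟨d - 2, by omega⟩
  have h1 := Finset.card_filter_add_card_filter_not (s := T) (fun z => z ∈ W)
  obtain ⟨F, hF, hF0, hFT⟩ := IH (e + 1) (by omega) (hT.residual_submodule W)
    (hi.mono (Finset.filter_subset _ _)) (by omega)
  refine ⟨F, hF, hF0, fun x hx => ?_⟩
  by_contra hxF
  have h4 := (hT.residual_poly hF).card_ge (hi.mono (Finset.filter_subset _ _))
    ⟨x, Finset.mem_filter.2 ⟨hx, hxF⟩⟩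
  have h5 : (T.filter fun x => ¬ eval x F = 0).card ≤ (T.filter fun x => x ∈ W).card := by
    refine Finset.card_le_card fun y hy => ?_
    rw [Finset.mem_filter] at hy ⊢
    exact ⟨hy.1, by_contra fun hyW => hy.2 (hFT y (Finset.mem_filter.2 ⟨hy.1, hyW⟩))⟩
  omega

end Plane

/-! ### Small Cayley–Bacharach sets in projective space -/

section Structure

variable {K : Type} [Field K] {n k : ℕ}

lemma exists_quadraticForm {F : MvPolynomial (Fin n) K} (hF : F.IsHomogeneous 2) :
    ∃ q : QuadraticForm K (Fin n → K), ∀ v, q v = eval v F := by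
  have hF' : F ∈ homogeneousSubmodule (Fin n) K 1 * homogeneousSubmodule (Fin n) K 1 := by
    rw [← pow_two, homogeneousSubmodule_one_pow]; exact hF
  induction hF' using Submodule.mul_induction_on' with
  | mem_mul_mem A hA B hB =>
    obtain ⟨f, rfl⟩ := exists_eq_dualPoly hA
    obtain ⟨g, rfl⟩ := exists_eq_dualPoly hB
    exact ⟨QuadraticMap.linMulLin f g, fun v => by simp⟩
  | add A hA B hB h1 h2 =>
    have hsub : homogeneousSubmodule (Fin n) K 1 * homogeneousSubmodule (Fin n) K 1 =
        homogeneousSubmodule (Fin n) K 2 := by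
      rw [← pow_two, homogeneousSubmodule_one_pow]
    obtain ⟨q, hq⟩ := h1 (hsub ▸ hA :)
    obtain ⟨q', hq'⟩ := h2 (hsub ▸ hB :)
    exact ⟨q + q', fun v => by simp [hq, hq']⟩

/-- The pullback of a form under a linear map. -/
lemma exists_pullback (φ : (Fin n → K) →ₗ[K] (Fin k → K)) {d : ℕ} {G : MvPolynomial (Fin k) K}
    (hG : G.IsHomogeneous d) :
    ∃ G' : MvPolynomial (Fin n) K, G'.IsHomogeneous d ∧ ∀ v, eval v G' = eval (φ v) G := by
  refine ⟨aeval (fun i => dualPoly ((LinearMap.proj i).comp φ)) G, ?_, fun v => ?_⟩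
  · simpa using hG.aeval (fun i => dualPoly ((LinearMap.proj i).comp φ))
      (fun i => dualPoly_isHomogeneous _)
  · rw [← aeval_eq_eval v, ← aeval_eq_eval (φ v)]
    rw [← AlgHom.comp_apply, comp_aeval]
    congr 2
    ext i
    change aeval v (dualPoly _) = _
    rw [aeval_eq_eval]
    simp

/-- Coordinates on a subspace, extended to the whole space. -/
lemma exists_coordinates {W : Submodule K (Fin n → K)} (hW : Module.finrank K W = k) :
    ∃ φ : (Fin n → K) →ₗ[K] (Fin k → K), (∀ x ∈ W, φ x = 0 → x = 0) ∧
      ∀ y, ∃ x ∈ W, φ x = y := by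
  let e : W ≃ₗ[K] (Fin k → K) := LinearEquiv.ofFinrankEq _ _ (by simpa using hW)
  obtain ⟨φ, hφ⟩ := e.toLinearMap.exists_extend
  have hφ' : ∀ x : W, φ x = e x := fun x => LinearMap.congr_fun hφ x
  refine ⟨φ, fun x hx h => ?_, fun y => ⟨e.symm y, (e.symm y).2, by simp [hφ']⟩⟩
  have := hφ' ⟨x, hx⟩
  rw [h] at this
  exact congrArg Subtype.val (e.map_eq_zero_iff.1 this.symm)

lemma PairwiseIndep.image {T : Finset (Fin n → K)} (hi : PairwiseIndep T)
    {W : Submodule K (Fin n → K)} (hTW : ∀ x ∈ T, x ∈ W) {φ : (Fin n → K) →ₗ[K] (Fin k → K)}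
    (hφ : ∀ x ∈ W, φ x = 0 → x = 0) : PairwiseIndep (T.image φ) := by
  intro x' hx'
  obtain ⟨x, hx, rfl⟩ := Finset.mem_image.1 hx'
  refine ⟨fun h => (hi x hx).1 (hφ x (hTW x hx) h), fun y' hy' hxy => ?_⟩
  obtain ⟨y, hy, rfl⟩ := Finset.mem_image.1 hy'
  obtain ⟨c, hc⟩ := Submodule.mem_span_singleton.1 hxy
  have : x - c • y = 0 := hφ _ (W.sub_mem (hTW x hx) (W.smul_mem c (hTW y hy)))
    (by rw [map_sub, map_smul, hc, sub_self])
  rw [(hi x hx).2 y hy (Submodule.mem_span_singleton.2 ⟨c, (sub_eq_zero.1 this).symm⟩)]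

lemma injOn_of_ker {W : Submodule K (Fin n → K)} {φ : (Fin n → K) →ₗ[K] (Fin k → K)}
    (hφ : ∀ x ∈ W, φ x = 0 → x = 0) {x y : Fin n → K} (hx : x ∈ W) (hy : y ∈ W)
    (h : φ x = φ y) : x = y :=
  sub_eq_zero.1 (hφ _ (W.sub_mem hx hy) (by rw [map_sub, h, sub_self]))

lemma CayleyBacharach.image {d : ℕ} {T : Finset (Fin n → K)} (hT : CayleyBacharach d T)
    {W : Submodule K (Fin n → K)} (hTW : ∀ x ∈ T, x ∈ W) {φ : (Fin n → K) →ₗ[K] (Fin k → K)}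
    (hφ : ∀ x ∈ W, φ x = 0 → x = 0) : CayleyBacharach d (T.image φ) := by
  intro G hG x' hx' hv
  obtain ⟨x, hx, rfl⟩ := Finset.mem_image.1 hx'
  obtain ⟨G', hG', hGG'⟩ := exists_pullback φ hG
  rw [← hGG']
  refine hT G' hG' x hx fun y hy hyx => ?_
  rw [hGG']
  exact hv _ (Finset.mem_image_of_mem φ hy) fun h =>
    hyx (injOn_of_ker hφ (hTW y hy) (hTW x hx) h)

lemma two_le_finrank {W : Submodule K (Fin n → K)} {x y : Fin n → K} (hx : x ∈ W) (hy : y ∈ W)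
    (hy0 : y ≠ 0) (hxy : x ∉ Submodule.span K {y}) : 2 ≤ Module.finrank K W := by
  have h : LinearIndependent K ![(⟨y, hy⟩ : W), ⟨x, hx⟩] := by
    rw [LinearIndependent.pair_iff' (by simpa [Subtype.ext_iff] using hy0)]
    intro a ha
    exact hxy (Submodule.mem_span_singleton.2 ⟨a, congrArg Subtype.val ha⟩)
  simpa using h.fintype_card_le_finrank

lemma PairwiseIndep.two_le_finrank {T : Finset (Fin n → K)} (hi : PairwiseIndep T)
    {W : Submodule K (Fin n → K)} (hTW : ∀ x ∈ T, x ∈ W) (hc : 2 ≤ T.card) :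
    2 ≤ Module.finrank K W := by
  obtain ⟨x, hx, y, hy, hxy⟩ := Finset.one_lt_card.1 hc
  exact VeroneseRank.two_le_finrank (hTW x hx) (hTW y hy) (hi y hy).1
    fun h => hxy ((hi x hx).2 y hy h)

lemma exists_mem_notMem_of_finrank {W W' : Submodule K (Fin n → K)}
    (h : Module.finrank K W = Module.finrank K W') (hne : W ≠ W') : ∃ x ∈ W, x ∉ W' := by
  by_contra! hle
  exact hne (Submodule.eq_of_le_of_finrank_eq hle h)

lemma PairwiseIndep.exists_plane {T : Finset (Fin n → K)} (hi : PairwiseIndep T)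
    (hc : 2 ≤ T.card) (hline : ∀ W : Submodule K (Fin n → K), Module.finrank K W ≤ 2 →
      ∃ x ∈ T, x ∉ W) :
    ∃ W : Submodule K (Fin n → K), Module.finrank K W = 3 ∧
      3 ≤ (T.filter fun x => x ∈ W).card := by
  obtain ⟨x, hx, y, hy, hxy⟩ := Finset.one_lt_card.1 hc
  set L := Submodule.span K ({x, y} : Set (Fin n → K)) with hL
  have hxL : x ∈ L := Submodule.subset_span (by simp)
  have hyL : y ∈ L := Submodule.subset_span (by simp)
  have hle : Module.finrank K L ≤ 2 := finrank_span_pair_le x y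
  obtain ⟨z, hz, hzL⟩ := hline L hle
  have h2 : 2 ≤ Module.finrank K L := VeroneseRank.two_le_finrank hxL hyL (hi y hy).1
    fun h => hxy ((hi x hx).2 y hy h)
  refine ⟨L ⊔ Submodule.span K {z}, ?_, ?_⟩
  · have hinf : L ⊓ Submodule.span K {z} = ⊥ := by
      rw [← disjoint_iff]
      exact (Submodule.disjoint_span_singleton' (hi z hz).1).2 hzL
    have h3 := Submodule.finrank_sup_add_finrank_inf_eq L (Submodule.span K {z})
    rw [hinf, finrank_bot, finrank_span_singleton (hi z hz).1] at h3
    omega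
  · have hsub : ({x, y, z} : Finset (Fin n → K)) ⊆
        T.filter fun v => v ∈ L ⊔ Submodule.span K {z} := by
      intro v hv
      simp only [Finset.mem_insert, Finset.mem_singleton] at hv
      rw [Finset.mem_filter]
      rcases hv with rfl | rfl | rfl
      · exact ⟨hx, Submodule.mem_sup_left hxL⟩
      · exact ⟨hy, Submodule.mem_sup_left hyL⟩
      · exact ⟨hz, Submodule.mem_sup_right (Submodule.mem_span_singleton_self _)⟩
    have h3 : ({x, y, z} : Finset (Fin n → K)).card = 3 :=
      Finset.card_eq_three.2 ⟨x, y, z, hxy, fun h => hzL (h ▸ hxL), fun h => hzL (h ▸ hyL), rfl⟩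
    exact h3 ▸ Finset.card_le_card hsub

/-- Two distinct lines are disjoint or lie in a plane, where their union is a conic. -/
lemma disjoint_or_exists_conic {W W' : Submodule K (Fin n → K)} (hW : Module.finrank K W = 2)
    (hW' : Module.finrank K W' = 2) (hne : W ≠ W') :
    Disjoint W W' ∨ ∃ (E : Submodule K (Fin n → K)) (q : QuadraticForm K (Fin n → K)),
      Module.finrank K E = 3 ∧ (∃ w ∈ E, q w ≠ 0) ∧ ∀ x, x ∈ W ∨ x ∈ W' → x ∈ E ∧ q x = 0 := by
  by_cases hd : Disjoint W W'
  · exact Or.inl hd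
  right
  obtain ⟨u, hu, huW'⟩ := exists_mem_notMem_of_finrank (hW.trans hW'.symm) hne
  obtain ⟨v, hv, hvW⟩ := exists_mem_notMem_of_finrank (hW'.trans hW.symm) hne.symm
  obtain ⟨f, hfv, hf⟩ := Submodule.exists_le_ker_of_notMem hvW
  obtain ⟨g, hgu, hg⟩ := Submodule.exists_le_ker_of_notMem huW'
  refine ⟨W ⊔ W', QuadraticMap.linMulLin f g, ?_, ⟨u + v, Submodule.add_mem_sup hu hv, ?_⟩, ?_⟩
  · have h1 := Submodule.finrank_sup_add_finrank_inf_eq W W'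
    have h2 : 0 < Module.finrank K (W ⊓ W' : Submodule K (Fin n → K)) := by
      rw [Module.finrank_pos_iff, Submodule.nontrivial_iff_ne_bot]
      rwa [disjoint_iff] at hd
    have h3 : Module.finrank K (W ⊓ W' : Submodule K (Fin n → K)) < 2 := by
      rw [← hW]
      refine Submodule.finrank_lt_finrank_of_lt (lt_of_le_of_ne inf_le_left fun h => ?_)
      exact huW' ((inf_eq_left.1 h) hu)
    omega
  · have h1 : f u = 0 := hf hu
    have h2 : g v = 0 := hg hv
    simpa [h1, h2] using ⟨hfv, hgu⟩
  · rintro x (hx | hx)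
    · have : f x = 0 := hf hx
      exact ⟨Submodule.mem_sup_left hx, by simp [this]⟩
    · have : g x = 0 := hg hx
      exact ⟨Submodule.mem_sup_right hx, by simp [this]⟩

/-- A Cayley–Bacharach set for degree `d` in a plane of a higher-dimensional space, of at most
`3 d - 1` points, lies on a conic. -/
lemma CayleyBacharach.exists_conic_of_plane [Infinite K] {d : ℕ} {T : Finset (Fin n → K)}
    (hT : CayleyBacharach d T) (hi : PairwiseIndep T) (hc : T.card + 1 ≤ 3 * d)
    {W : Submodule K (Fin n → K)} (hW : Module.finrank K W = 3) (hTW : ∀ x ∈ T, x ∈ W) :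
    ∃ q : QuadraticForm K (Fin n → K), (∃ w ∈ W, q w ≠ 0) ∧ ∀ x ∈ T, q x = 0 := by
  obtain ⟨φ, hφ, hsurj⟩ := exists_coordinates hW
  obtain ⟨F, hF, hF0, hFT⟩ := (hT.image hTW hφ).exists_conic (hi.image hTW hφ)
    (by have := Finset.card_image_le (s := T) (f := φ); omega)
  obtain ⟨F', hF', hFF'⟩ := exists_pullback φ hF
  obtain ⟨q, hq⟩ := exists_quadraticForm hF'
  refine ⟨q, ?_, fun x hx => by rw [hq, hFF']; exact hFT _ (Finset.mem_image_of_mem φ hx)⟩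
  by_contra! h0
  refine hF0 (hF.eq_zero_of_forall_eval_eq_zero fun y => ?_)
  obtain ⟨x, hx, rfl⟩ := hsurj y
  rw [← hFF', ← hq, h0 x hx]

/-- A Cayley–Bacharach set for degree `d` of at most `3 d - 1` points lies on a line, on two
disjoint lines, or on a plane conic. -/
theorem CayleyBacharach.line_or_lines_or_conic [Infinite K] {d : ℕ} {T : Finset (Fin n → K)}
    (hT : CayleyBacharach d T) (hi : PairwiseIndep T) (hc : T.card + 1 ≤ 3 * d)
    (hne : T.Nonempty) :
    (∃ W : Submodule K (Fin n → K), Module.finrank K W = 2 ∧ ∀ x ∈ T, x ∈ W) ∨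
    (∃ W W' : Submodule K (Fin n → K), Module.finrank K W = 2 ∧ Module.finrank K W' = 2 ∧
      Disjoint W W' ∧ ∀ x ∈ T, x ∈ W ∨ x ∈ W') ∨
    ∃ (W : Submodule K (Fin n → K)) (q : QuadraticForm K (Fin n → K)),
      Module.finrank K W = 3 ∧ (∃ w ∈ W, q w ≠ 0) ∧ ∀ x ∈ T, x ∈ W ∧ q x = 0 := by
  induction d generalizing T with
  | zero => omega
  | succ d IH =>
  have hc2 := hT.card_ge hi hne
  rw [or_iff_not_imp_left]
  intro hL
  have hline : ∀ W : Submodule K (Fin n → K), Module.finrank K W ≤ 2 → ∃ x ∈ T, x ∉ W := by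
    intro W hW
    by_contra! h
    exact hL ⟨W, le_antisymm hW (hi.two_le_finrank h (by omega)), h⟩
  have hbig : 2 * (d + 1) + 1 < T.card := by
    by_contra! h
    obtain ⟨W, hW, hTW⟩ := hT.collinear hi h
    obtain ⟨x, hx, hxW⟩ := hline W hW
    exact hxW (hTW x hx)
  have res : ∀ W : Submodule K (Fin n → K), (∃ x ∈ T, x ∉ W) →
      d + 2 ≤ (T.filter fun x => x ∉ W).card := by
    rintro W ⟨x, hx, hxW⟩
    exact (hT.residual_submodule W).card_ge (hi.mono (Finset.filter_subset _ _))
      ⟨x, Finset.mem_filter.2 ⟨hx, hxW⟩⟩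
  by_cases hex : ∃ W : Submodule K (Fin n → K), Module.finrank K W ≤ 2 ∧
      d + 1 ≤ (T.filter fun x => x ∈ W).card
  · obtain ⟨W, hW, hdW⟩ := hex
    obtain ⟨W', hW', hcov⟩ := hT.exists_two_lines hi hc hdW
    obtain ⟨x, hx, hxW⟩ := hline W hW
    have hW2 : Module.finrank K W = 2 := le_antisymm hW <|
      (hi.mono (Finset.filter_subset (fun x => x ∈ W) _)).two_le_finrank
        (fun y hy => (Finset.mem_filter.1 hy).2) (le_trans (by omega) hdW)
    have hW2' : Module.finrank K W' = 2 := le_antisymm hW' <|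
      (hi.mono (Finset.filter_subset _ _)).two_le_finrank
        (fun y hy => hcov y (Finset.mem_filter.1 hy).1 (Finset.mem_filter.1 hy).2)
        (le_trans (by omega) (res W ⟨x, hx, hxW⟩))
    have hcov' : ∀ x ∈ T, x ∈ W ∨ x ∈ W' := fun x hx => or_iff_not_imp_left.2 (hcov x hx)
    rcases disjoint_or_exists_conic hW2 hW2' (fun h => hxW (h ▸ hcov x hx hxW)) with
      hd | ⟨E, q, hE, hq, hEq⟩
    · exact Or.inl ⟨W, W', hW2, hW2', hd, hcov'⟩
    · exact Or.inr ⟨E, q, hE, hq, fun x hx => hEq x (hcov' x hx)⟩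
  push Not at hex
  -- No line contains more than `d` of the points. Then the points lie in a plane.
  suffices hplane : ∃ W : Submodule K (Fin n → K), Module.finrank K W = 3 ∧ ∀ x ∈ T, x ∈ W by
    obtain ⟨W, hW, hTW⟩ := hplane
    obtain ⟨q, hq, hqT⟩ := hT.exists_conic_of_plane hi hc hW hTW
    exact Or.inr ⟨W, q, hW, hq, fun x hx => ⟨hTW x hx, hqT x hx⟩⟩
  by_contra! hplane
  have few : ∀ (W : Submodule K (Fin n → K)) (S : Finset (Fin n → K)), Module.finrank K W = 2 →
      S ⊆ T → (∀ x ∈ S, x ∈ W) → S.card < d + 1 := fun W S hW hST hSW =>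
    lt_of_le_of_lt (Finset.card_le_card fun x hx => Finset.mem_filter.2 ⟨hST hx, hSW x hx⟩)
      (hex W hW.le)
  obtain ⟨M, hM, hM3⟩ := hi.exists_plane (by omega) hline
  set S := T.filter fun x => x ∉ M with hS
  have hST : S ⊆ T := Finset.filter_subset _ _
  have hSc : d + 2 ≤ S.card := res M (hplane M hM)
  have hST' : (T.filter fun x => x ∈ M).card + S.card = T.card :=
    Finset.card_filter_add_card_filter_not (s := T) (fun z => z ∈ M)
  have hCB : CayleyBacharach d S := hT.residual_submodule M
  rcases IH hCB (hi.mono hST) (by omega) (Finset.card_pos.1 (by omega)) with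
    ⟨W, hW, hSW⟩ | ⟨W, W', hW, hW', -, hSW⟩ | ⟨E, q, hE, -, hSE⟩
  · have := few W S hW hST hSW
    omega
  · obtain ⟨e, rfl⟩ : ∃ e, d = e + 1 := ⟨d - 1, by omega⟩
    have h1 := few W _ hW ((Finset.filter_subset (fun x => x ∈ W) S).trans hST)
      fun x hx => (Finset.mem_filter.1 hx).2
    have h2 := few W' _ hW' ((Finset.filter_subset (fun x => x ∉ W) S).trans hST)
      fun x hx => (hSW x (Finset.mem_filter.1 hx).1).resolve_left (Finset.mem_filter.1 hx).2
    have h3 := Finset.card_filter_add_card_filter_not (s := S) (fun z => z ∈ W)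
    have h4 := (hCB.residual_submodule W).card_ge (hi.mono ((Finset.filter_subset _ _).trans hST))
      (Finset.card_pos.1 (by omega))
    omega
  · have h1 : 2 * d + 1 < S.card := by
      by_contra! h
      obtain ⟨W, hW, hSW⟩ := hCB.collinear (hi.mono hST) h
      have h2 := few W S (le_antisymm hW ((hi.mono hST).two_le_finrank hSW (by omega))) hST hSW
      omega
    have h2 := res E (hplane E hE)
    have h3 : S.card ≤ (T.filter fun x => x ∈ E).card :=
      Finset.card_le_card fun x hx => Finset.mem_filter.2 ⟨hST hx, (hSE x hx).1⟩
    have h4 := Finset.card_filter_add_card_filter_not (s := T) (fun z => z ∈ E)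
    omega

end Structure

/-! ### Projective spans and linear spans -/

section Span

variable {K : Type} [Field K] {m d : ℕ}

/-- A representative `L_x ^ d` of the point `ν_d(x)`. -/
noncomputable def powRep (d : ℕ) (x : PSpace K m) : Form K m d := powForm d x.rep

/-- The linear span in the space of forms of the cone over `ν_d(S)`. -/
noncomputable def verSub (d : ℕ) (S : Set (PSpace K m)) : Submodule K (Form K m d) :=
  Submodule.span K (powRep d '' S)

lemma powRep_mem_verSub {S : Set (PSpace K m)} {x : PSpace K m} (hx : x ∈ S) :
    powRep d x ∈ verSub d S :=
  Submodule.subset_span ⟨x, hx, rfl⟩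

lemma verSub_mono {S T : Set (PSpace K m)} (h : S ⊆ T) : verSub d S ≤ verSub d T :=
  Submodule.span_mono (Set.image_mono h)

lemma verSub_union (S T : Set (PSpace K m)) : verSub d (S ∪ T) = verSub d S ⊔ verSub d T := by
  rw [verSub, Set.image_union, Submodule.span_union]; rfl

lemma veronese_eq_mk (x : PSpace K m) :
    veronese d x = Projectivization.mk K (powRep d x) (powForm_ne_zero d x.rep_nonzero) := by
  conv_lhs => rw [← x.mk_rep]
  rfl

lemma verSpan_eq (S : Set (PSpace K m)) : verSpan d S = (verSub d S).projectivization := by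
  apply le_antisymm
  · rw [verSpan, Projectivization.Subspace.span_le_subspace_iff]
    rintro _ ⟨x, hx, rfl⟩
    rw [veronese_eq_mk]
    exact powRep_mem_verSub hx
  · rw [Submodule.projectivization, OrderIso.symm_apply_le, verSub, Submodule.span_le]
    rintro _ ⟨x, hx, rfl⟩
    have h0 : powRep d x ≠ 0 := powForm_ne_zero d x.rep_nonzero
    rw [SetLike.mem_coe, Projectivization.Subspace.mem_submodule_iff _ h0]
    refine Projectivization.Subspace.subset_span _ ⟨x, hx, ?_⟩
    rw [veronese_eq_mk]

lemma mk_mem_verSpan {S : Set (PSpace K m)} {p : Form K m d} (hp : p ≠ 0) :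
    Projectivization.mk K p hp ∈ verSpan d S ↔ p ∈ verSub d S := by
  rw [verSpan_eq, Submodule.mk_mem_projectivization_iff]

lemma span_singleton_mk {V : Type} [AddCommGroup V] [Module K V] {p : V} (hp : p ≠ 0) :
    Projectivization.Subspace.span {Projectivization.mk K p hp} =
      (Submodule.span K {p}).projectivization := by
  apply le_antisymm
  · rw [Projectivization.Subspace.span_le_subspace_iff, Set.singleton_subset_iff]
    exact Submodule.mem_span_singleton_self p
  · rw [Submodule.projectivization, OrderIso.symm_apply_le, Submodule.span_singleton_le_iff_mem,
      Projectivization.Subspace.mem_submodule_iff _ hp]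
    exact Projectivization.Subspace.subset_span _ rfl

lemma span_insert_veronese {p : Form K m d} (hp : p ≠ 0) (S : Set (PSpace K m)) :
    Projectivization.Subspace.span ({Projectivization.mk K p hp} ∪ veronese d '' S) =
      (Submodule.span K {p} ⊔ verSub d S).projectivization := by
  rw [Projectivization.Subspace.span_union, span_singleton_mk, map_sup, ← verSpan_eq]
  rfl

/-- A projective linear space meeting another one in the point `[o]`. -/
lemma coe_inter_eq_singleton {V : Type} [AddCommGroup V] [Module K V] {E F : Submodule K V} {o : V}
    (ho : o ≠ 0) (h : E ⊓ F = Submodule.span K {o}) :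
    ((E.projectivization : Projectivization.Subspace K V) : Set (ℙ K V)) ∩ F.projectivization =
      {Projectivization.mk K o ho} := by
  ext x
  induction x using Projectivization.ind with
  | h v hv =>
  rw [Set.mem_inter_iff, SetLike.mem_coe, SetLike.mem_coe, Submodule.mk_mem_projectivization_iff,
    Submodule.mk_mem_projectivization_iff, ← Submodule.mem_inf, h, Set.mem_singleton_iff,
    Projectivization.mk_eq_mk_iff', Submodule.mem_span_singleton]

lemma mem_projectivization_iff {V : Type} [AddCommGroup V] [Module K V] {W : Submodule K V}
    {x : ℙ K V} : x ∈ W.projectivization ↔ x.rep ∈ W := by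
  rw [Submodule.mem_projectivization_iff_submodule_le, Projectivization.submodule_eq,
    Submodule.span_singleton_le_iff_mem]

lemma rep_mem_span_iff {V : Type} [AddCommGroup V] [Module K V] {x y : ℙ K V} :
    x.rep ∈ Submodule.span K {y.rep} ↔ x = y := by
  rw [Submodule.mem_span_singleton, ← Projectivization.mk_eq_mk_iff' K _ _ x.rep_nonzero
    y.rep_nonzero, x.mk_rep, y.mk_rep]

lemma rep_injective {V : Type} [AddCommGroup V] [Module K V] :
    Function.Injective (Projectivization.rep : ℙ K V → V) := fun x y h => by
  rw [← x.mk_rep, ← y.mk_rep]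
  simp only [h]

end Span

/-! ### Minimal decompositions -/

section Minimal

variable {K : Type} [Field K] {m d : ℕ}

/-- `A` is a finite set of least cardinality such that `p` is a linear combination of the powers
`L_x ^ d`, `x ∈ A`. -/
def IsMinimal (d : ℕ) (A : Set (PSpace K m)) (p : Form K m d) : Prop :=
  A.Finite ∧ p ∈ verSub d A ∧
    ∀ S : Set (PSpace K m), S.Finite → p ∈ verSub d S → A.ncard ≤ S.ncard

lemma evinces_mk_iff {A : Set (PSpace K m)} {p : Form K m d} (hp : p ≠ 0) :
    Evinces A (Projectivization.mk K p hp) ↔ IsMinimal d A p := by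
  constructor
  · rintro ⟨hfin, hmem, hcard⟩
    refine ⟨hfin, (mk_mem_verSpan hp).1 hmem, fun S hS hpS => ?_⟩
    rw [hcard]
    exact Nat.sInf_le ⟨S, hS, rfl, (mk_mem_verSpan hp).2 hpS⟩
  · rintro ⟨hfin, hmem, hmin⟩
    have hmem' := (mk_mem_verSpan hp).2 hmem
    refine ⟨hfin, hmem', le_antisymm ?_ (Nat.sInf_le ⟨A, hfin, rfl, hmem'⟩)⟩
    obtain ⟨S, hS, hSc, hpS⟩ := Nat.sInf_mem (⟨_, A, hfin, rfl, hmem'⟩ :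
      {n : ℕ | ∃ S : Set (PSpace K m), S.Finite ∧ S.ncard = n ∧
        Projectivization.mk K p hp ∈ verSpan d S}.Nonempty)
    rw [symRank, ← hSc]
    exact hmin S hS ((mk_mem_verSpan hp).1 hpS)

/-- A part of a minimal decomposition is a minimal decomposition of the corresponding summand. -/
lemma IsMinimal.subset {A A' : Set (PSpace K m)} {p q : Form K m d} (hA : IsMinimal d A p)
    (hsub : A' ⊆ A) (hq : q ∈ verSub d A') (hpq : p - q ∈ verSub d (A \ A')) :
    IsMinimal d A' q := by
  refine ⟨hA.1.subset hsub, hq, fun S hS hqS => ?_⟩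
  have h1 : p ∈ verSub d (S ∪ A \ A') := by
    rw [verSub_union]
    exact (add_sub_cancel q p) ▸ Submodule.add_mem_sup hqS hpq
  have h2 := hA.2.2 _ (hS.union hA.1.sdiff) h1
  have h3 := Set.ncard_union_le S (A \ A')
  have h4 := Set.ncard_sdiff_add_ncard_of_subset hsub hA.1
  omega

lemma IsMinimal.ne_zero {A : Set (PSpace K m)} {p : Form K m d} (hA : IsMinimal d A p)
    (hne : A.Nonempty) : p ≠ 0 := by
  rintro rfl
  have := hA.2.2 ∅ Set.finite_empty (Submodule.zero_mem _)
  rw [Set.ncard_empty, Nat.le_zero, Set.ncard_eq_zero hA.1] at this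
  exact hne.ne_empty this

lemma mem_verSub_iff {S : Set (PSpace K m)} {p : Form K m d} :
    p ∈ verSub d S ↔ ∃ a : PSpace K m →₀ K, (a.support : Set (PSpace K m)) ⊆ S ∧
      Finsupp.linearCombination K (powRep d) a = p := by
  rw [verSub, Finsupp.mem_span_image_iff_linearCombination]
  rfl

/-- In a minimal decomposition all coefficients are nonzero. -/
lemma IsMinimal.exists_finsupp {A : Set (PSpace K m)} {p : Form K m d} (hA : IsMinimal d A p) :
    ∃ a : PSpace K m →₀ K, (a.support : Set (PSpace K m)) = A ∧
      Finsupp.linearCombination K (powRep d) a = p := by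
  obtain ⟨a, ha, hap⟩ := mem_verSub_iff.1 hA.2.1
  refine ⟨a, Set.eq_of_subset_of_ncard_le ha ?_ hA.1, hap⟩
  exact hA.2.2 _ a.support.finite_toSet (mem_verSub_iff.2 ⟨a, subset_rfl, hap⟩)

lemma linearCombination_filter_mem (a : PSpace K m →₀ K) (Z : Set (PSpace K m)) :
    Finsupp.linearCombination K (powRep d) (a.filter (· ∈ Z)) ∈
      verSub d ((a.support : Set (PSpace K m)) ∩ Z) := by
  refine mem_verSub_iff.2 ⟨_, fun x hx => ?_, rfl⟩
  simp only [Finsupp.support_filter, Finset.coe_filter, Set.mem_ofPred_eq] at hx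
  exact ⟨hx.1, hx.2⟩

lemma linearCombination_filter_notMem (a : PSpace K m →₀ K) (Z : Set (PSpace K m)) :
    Finsupp.linearCombination K (powRep d) (a.filter (· ∉ Z)) ∈
      verSub d ((a.support : Set (PSpace K m)) \ Z) := by
  refine mem_verSub_iff.2 ⟨_, fun x hx => ?_, rfl⟩
  simp only [Finsupp.support_filter, Finset.coe_filter, Set.mem_ofPred_eq] at hx
  exact ⟨hx.1, hx.2⟩

lemma linearCombination_sub_filter_mem (a : PSpace K m →₀ K) (Z : Set (PSpace K m)) :
    Finsupp.linearCombination K (powRep d) a -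
      Finsupp.linearCombination K (powRep d) (a.filter (· ∈ Z)) ∈
      verSub d ((a.support : Set (PSpace K m)) \ Z) := by
  have h : a - a.filter (· ∈ Z) = a.filter (· ∉ Z) := by
    rw [sub_eq_iff_eq_add', Finsupp.filter_add_filter_not]
  rw [← map_sub, h]
  exact linearCombination_filter_notMem a Z

/-- The part of a minimal decomposition in `Z` is a minimal decomposition of its sum. -/
lemma IsMinimal.inter {A : Set (PSpace K m)} {p : Form K m d} (hA : IsMinimal d A p)
    {a : PSpace K m →₀ K} (ha : (a.support : Set (PSpace K m)) = A)
    (hap : Finsupp.linearCombination K (powRep d) a = p) (Z : Set (PSpace K m)) :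
    IsMinimal d (A ∩ Z) (Finsupp.linearCombination K (powRep d) (a.filter (· ∈ Z))) := by
  subst ha hap
  refine hA.subset Set.inter_subset_left (linearCombination_filter_mem a Z) ?_
  rw [Set.sdiff_self_inter]
  exact linearCombination_sub_filter_mem a Z

end Minimal

/-! ### Apolarity -/

section Apolar

variable {K : Type} [Field K] {m d : ℕ}

lemma pderiv_linForm (i : Fin (m + 1)) (v : Fin (m + 1) → K) :
    pderiv i (linForm v) = C (v i) := by
  simp [linForm, pderiv_X, Pi.single_apply]

/-- Apolarity: evaluation of a form of degree `d` at `v` is a linear functional of `L_v ^ d`. -/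
lemma exists_apolar [CharZero K] {G : MvPolynomial (Fin (m + 1)) K} (hG : G.IsHomogeneous d) :
    ∃ φ : MvPolynomial (Fin (m + 1)) K →ₗ[K] K, ∀ v, φ (linForm v ^ d) = eval v G := by
  have mono : ∀ (d : ℕ) (s : Fin (m + 1) →₀ ℕ), s.degree = d →
      ∃ φ : MvPolynomial (Fin (m + 1)) K →ₗ[K] K,
        ∀ v, φ (linForm v ^ d) = eval v (monomial s (1 : K)) := by
    intro d
    induction d with
    | zero =>
      intro s hs
      obtain rfl : s = 0 := (Finsupp.degree_eq_zero_iff s).1 hs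
      exact ⟨(lcoeff K 0), fun v => by simp⟩
    | succ d ih =>
      intro s hs
      obtain ⟨i, hi⟩ : ∃ i, s i ≠ 0 := by
        by_contra! h
        have : s = 0 := Finsupp.ext h
        simp [this] at hs
      obtain ⟨β, rfl⟩ : ∃ β, s = β + Finsupp.single i 1 := by
        refine ⟨s - Finsupp.single i 1, (tsub_add_cancel_of_le ?_).symm⟩
        rw [Finsupp.single_le_iff]
        omega
      have hdeg : β.degree = d := by
        rw [map_add, Finsupp.degree_single] at hs
        omega
      obtain ⟨φ, hφ⟩ := ih _ hdeg
      refine ⟨((d + 1 : ℕ) : K)⁻¹ • φ ∘ₗ (pderiv i).toLinearMap, fun v => ?_⟩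
      have hne : ((d + 1 : ℕ) : K) ≠ 0 := Nat.cast_ne_zero.2 (Nat.succ_ne_zero d)
      have h1 : pderiv i (linForm v ^ (d + 1)) =
          (((d + 1 : ℕ) : K) * v i) • linForm v ^ d := by
        rw [Derivation.leibniz_pow, pderiv_linForm, Nat.add_sub_cancel, smul_eq_C_mul, C_mul,
          map_natCast]
        simp only [nsmul_eq_mul, smul_eq_mul]
        ring
      rw [LinearMap.smul_apply, LinearMap.comp_apply]
      change _ • φ (pderiv i (linForm v ^ (d + 1))) = _
      rw [h1, map_smul, hφ, smul_eq_mul, smul_eq_mul, ← mul_assoc, ← mul_assoc,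
        inv_mul_cancel₀ hne, one_mul]
      have h2 : (monomial (β + Finsupp.single i 1) (1 : K)) = monomial β 1 * X i := by
        rw [X, monomial_mul, one_mul]
      rw [h2, map_mul, eval_X, mul_comm]
  rw [G.as_sum]
  have hs : ∀ s ∈ G.support, s.degree = d := fun s hs => by
    by_contra h
    exact (mem_support_iff.1 hs) (hG.coeff_eq_zero h)
  choose! φ hφ using mono d
  refine ⟨∑ s ∈ G.support, coeff s G • φ s, fun v => ?_⟩
  rw [LinearMap.sum_apply, map_sum]
  refine Finset.sum_congr rfl fun s hs' => ?_
  rw [LinearMap.smul_apply, hφ s (hs s hs') v]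
  simp [eval_monomial]

/-- A relation between powers of linear forms is a relation between evaluations. -/
lemma sum_eval_eq_zero [CharZero K] {c : PSpace K m →₀ K}
    (hc : Finsupp.linearCombination K (powRep d) c = 0) {G : MvPolynomial (Fin (m + 1)) K}
    (hG : G.IsHomogeneous d) : c.sum (fun x t => t * eval x.rep G) = 0 := by
  obtain ⟨φ, hφ⟩ := exists_apolar hG
  have h := congrArg (fun F : Form K m d => φ F.1) hc
  simp only [Finsupp.linearCombination_apply] at h
  change (φ ∘ₗ Submodule.subtype _) (c.sum fun x t => t • powRep d x) = φ 0 at h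
  rw [map_finsuppSum, map_zero] at h
  rw [← h]
  refine Finsupp.sum_congr fun x _ => ?_
  rw [map_smul, smul_eq_mul, LinearMap.comp_apply]
  exact congrArg _ (hφ x.rep).symm

/-- The points of `S`, as vectors. -/
noncomputable def repSet (S : Finset (PSpace K m)) : Finset (Fin (m + 1) → K) :=
  S.image Projectivization.rep

lemma card_repSet (S : Finset (PSpace K m)) : (repSet S).card = S.card :=
  Finset.card_image_of_injective _ rep_injective

lemma forall_mem_repSet {S : Finset (PSpace K m)} {p : (Fin (m + 1) → K) → Prop} :
    (∀ v ∈ repSet S, p v) ↔ ∀ x ∈ S, p x.rep := by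
  simp [repSet]

lemma pairwiseIndep_repSet (S : Finset (PSpace K m)) : PairwiseIndep (repSet S) := by
  refine forall_mem_repSet.2 fun x _ => ⟨x.rep_nonzero, forall_mem_repSet.2 fun y _ h => ?_⟩
  rw [rep_mem_span_iff.1 h]

lemma cayleyBacharach_support [CharZero K] {c : PSpace K m →₀ K}
    (hc : Finsupp.linearCombination K (powRep d) c = 0) :
    CayleyBacharach d (repSet c.support) := by
  intro G hG
  refine forall_mem_repSet.2 fun x hx hv => ?_
  have h := sum_eval_eq_zero hc hG
  rw [Finsupp.sum, Finset.sum_eq_single_of_mem x hx fun y hy hyx => by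
    rw [forall_mem_repSet.1 hv y hy (rep_injective.ne hyx), mul_zero]] at h
  exact (mul_eq_zero.1 h).resolve_left (Finsupp.mem_support_iff.1 hx)

end Apolar

/-! ### Linear substitutions in forms -/

section Substitution

variable {K : Type} [Field K] {m d : ℕ}

lemma linForm_add (v w : Fin (m + 1) → K) : linForm (v + w) = linForm v + linForm w := by
  simp [linForm, add_mul, Finset.sum_add_distrib]

/-- The action of a linear map on forms, determined by `L_v ^ d ↦ L_(π v) ^ d`. -/
lemma exists_substitution (π : (Fin (m + 1) → K) →ₗ[K] (Fin (m + 1) → K)) (d : ℕ) :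
    ∃ σ : Form K m d →ₗ[K] Form K m d, ∀ v, σ (powForm d v) = powForm d (π v) := by
  let ℓ : (Fin (m + 1) → K) →ₗ[K] MvPolynomial (Fin (m + 1)) K :=
    { toFun := linForm
      map_add' := linForm_add
      map_smul' := fun t v => by rw [linForm_smul, RingHom.id_apply, smul_eq_C_mul] }
  let s : MvPolynomial (Fin (m + 1)) K →ₐ[K] MvPolynomial (Fin (m + 1)) K :=
    aeval fun i => linForm (π (Pi.single i 1))
  have hs : ∀ v, s (linForm v) = linForm (π v) := by
    intro v
    change _ = ℓ (π v)
    rw [← LinearMap.comp_apply, LinearMap.pi_apply_eq_sum_univ (ℓ ∘ₗ π) v, linForm, map_sum]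
    refine Finset.sum_congr rfl fun i _ => ?_
    rw [map_mul, aeval_X, ← algebraMap_eq, AlgHom.commutes, ← Algebra.smul_def]
    congr 3
    ext j
    simp [Pi.single_apply, eq_comm]
  refine ⟨s.toLinearMap.restrict fun p hp => ?_, fun v => Subtype.ext ?_⟩
  · have := IsHomogeneous.aeval (n := 1) hp (fun i => linForm (π (Pi.single i 1)))
      (fun i => linForm_isHomogeneous _)
    rw [one_mul] at this
    exact this
  · change s (linForm v ^ d) = linForm (π v) ^ d
    rw [map_pow, hs]

lemma powForm_zero (hd : d ≠ 0) : powForm d (0 : Fin (m + 1) → K) = 0 := by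
  apply Subtype.ext
  simp [powForm, linForm, hd]

end Substitution

/-! ### Complexification of real decompositions -/

section Complexification

variable {m d : ℕ}

lemma toC_eq_mk (s : PSpace ℝ m) : toC s = Projectivization.mk ℂ (vecToComplex s.rep)
    ((map_ne_zero_iff _ vecToComplex_injective).2 s.rep_nonzero) := by
  conv_lhs => rw [← s.mk_rep]
  rfl

lemma toC_injective : Function.Injective (toC : PSpace ℝ m → PSpace ℂ m) := by
  intro s t h
  rw [toC_eq_mk, toC_eq_mk, Projectivization.mk_eq_mk_iff'] at h
  obtain ⟨c, hc⟩ := h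
  obtain ⟨i, hi⟩ := Function.ne_iff.1 t.rep_nonzero
  have hcoord : ∀ j, c * (t.rep j : ℂ) = (s.rep j : ℂ) := fun j => congrFun hc j
  have hi' : (t.rep i : ℂ) ≠ 0 := Complex.ofReal_ne_zero.2 hi
  have hreal : c = ((s.rep i / t.rep i : ℝ) : ℂ) := by
    rw [Complex.ofReal_div, ← hcoord i, mul_div_cancel_right₀ _ hi']
  rw [← s.mk_rep, ← t.mk_rep, Projectivization.mk_eq_mk_iff']
  refine ⟨s.rep i / t.rep i, funext fun j => Complex.ofReal_injective ?_⟩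
  rw [← hcoord j, hreal, Pi.smul_apply, smul_eq_mul, Complex.ofReal_mul]

lemma toC_mem_projectivization {W : Submodule ℂ (Fin (m + 1) → ℂ)} {s : PSpace ℝ m} :
    toC s ∈ W.projectivization ↔ vecToComplex s.rep ∈ W := by
  rw [toC_eq_mk, Submodule.mk_mem_projectivization_iff]

lemma formToC_mk {p : Form ℝ m d} (hp : p ≠ 0) :
    formToC (Projectivization.mk ℝ p hp) = Projectivization.mk ℂ (formToComplex p)
      ((map_ne_zero_iff _ formToComplex_injective).2 hp) := rfl

lemma map_linForm (v : Fin (m + 1) → ℝ) :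
    MvPolynomial.map (algebraMap ℝ ℂ) (linForm v) = linForm (vecToComplex v) := by
  simp [linForm, vecToComplex]

lemma formToComplex_powForm (v : Fin (m + 1) → ℝ) :
    formToComplex (powForm d v) = powForm d (vecToComplex v) := by
  apply Subtype.ext
  change MvPolynomial.map (algebraMap ℝ ℂ) (linForm v ^ d) = linForm (vecToComplex v) ^ d
  rw [map_pow, map_linForm]

lemma exists_formToComplex_powRep (s : PSpace ℝ m) :
    ∃ w : ℂ, w ≠ 0 ∧ formToComplex (powRep d s) = w • powRep d (toC s) := by
  obtain ⟨u, hu⟩ := Projectivization.exists_smul_eq_mk_rep ℂ (vecToComplex s.rep)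
    ((map_ne_zero_iff _ vecToComplex_injective).2 s.rep_nonzero)
  rw [← toC_eq_mk] at hu
  refine ⟨((u : ℂ) ^ d)⁻¹, inv_ne_zero (pow_ne_zero _ u.ne_zero), ?_⟩
  rw [powRep, powRep, ← hu, Units.smul_def, powForm_smul, smul_smul,
    inv_mul_cancel₀ (pow_ne_zero _ u.ne_zero), one_smul, formToComplex_powForm]

/-- A real combination of powers of linear forms, as a complex one. -/
lemma exists_complexification (r : PSpace ℝ m →₀ ℝ) :
    ∃ b : PSpace ℂ m →₀ ℂ, (b.support : Set (PSpace ℂ m)) = toC '' r.support ∧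
      ∀ Z : Set (PSpace ℂ m), Finsupp.linearCombination ℂ (powRep d) (b.filter (· ∈ Z)) =
        formToComplex (Finsupp.linearCombination ℝ (powRep d) (r.filter (· ∈ toC ⁻¹' Z))) := by
  choose w hw0 hw using exists_formToComplex_powRep (m := m) (d := d)
  let g : PSpace ℝ m →₀ ℂ := Finsupp.onFinset r.support (fun s => (r s : ℂ) * w s) (by
    intro s hs
    rw [Finsupp.mem_support_iff]
    rintro h
    simp [h] at hs)
  let f : PSpace ℝ m ↪ PSpace ℂ m := ⟨toC, toC_injective⟩
  have hg : g.support = r.support := by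
    ext s
    simp [g, hw0]
  have hsupp : (g.embDomain f).support = r.support.map f := by
    rw [Finsupp.support_embDomain, hg]
  refine ⟨g.embDomain f, by rw [hsupp, Finset.coe_map]; rfl, fun Z => ?_⟩
  rw [Finsupp.linearCombination_apply, Finsupp.linearCombination_apply, Finsupp.sum_filter_index,
    Finsupp.sum_filter_index, map_sum, Finsupp.support_filter, Finsupp.support_filter, hsupp,
    Finset.sum_filter, Finset.sum_filter, Finset.sum_map]
  refine Finset.sum_congr rfl fun s _ => ?_
  by_cases hs : toC s ∈ Z
  · have h1 : f s ∈ Z := hs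
    have h2 : s ∈ toC ⁻¹' Z := hs
    rw [if_pos h1, if_pos h2, Finsupp.embDomain_apply_self, map_smulₛₗ, hw, smul_smul]
    rfl
  · have h1 : f s ∉ Z := hs
    have h2 : s ∉ toC ⁻¹' Z := hs
    rw [if_neg h1, if_neg h2]

end Complexification

/-! ### Comparison of a real and a complex decomposition -/

section Comparison

variable {m d : ℕ}

/-- Minimal decompositions of a real form `p`, over `ℂ` with support `A` and coefficients `a`, over
`ℝ` with support `R` and coefficients `r`; the coefficients `b` are those of the real decomposition
seen over `ℂ`. -/
structure Decompositions (p : Form ℝ m d) (A : Set (PSpace ℂ m)) (R : Set (PSpace ℝ m))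
    (a b : PSpace ℂ m →₀ ℂ) (r : PSpace ℝ m →₀ ℝ) : Prop where
  minA : IsMinimal d A (formToComplex p)
  minR : IsMinimal d R p
  suppA : (a.support : Set (PSpace ℂ m)) = A
  sumA : Finsupp.linearCombination ℂ (powRep d) a = formToComplex p
  suppR : (r.support : Set (PSpace ℝ m)) = R
  sumR : Finsupp.linearCombination ℝ (powRep d) r = p
  suppB : (b.support : Set (PSpace ℂ m)) = toC '' R
  filterB : ∀ Z : Set (PSpace ℂ m), Finsupp.linearCombination ℂ (powRep d) (b.filter (· ∈ Z)) =
    formToComplex (Finsupp.linearCombination ℝ (powRep d) (r.filter (· ∈ toC ⁻¹' Z)))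

lemma exists_decompositions {p : Form ℝ m d} {A : Set (PSpace ℂ m)} {R : Set (PSpace ℝ m)}
    (hA : IsMinimal d A (formToComplex p)) (hR : IsMinimal d R p) :
    ∃ a b r, Decompositions p A R a b r := by
  obtain ⟨a, ha, hap⟩ := hA.exists_finsupp
  obtain ⟨r, hr, hrp⟩ := hR.exists_finsupp
  obtain ⟨b, hb, hbZ⟩ := exists_complexification (d := d) r
  exact ⟨a, b, r, hA, hR, ha, hap, hr, hrp, by rw [hb, hr], hbZ⟩

variable {p : Form ℝ m d} {A : Set (PSpace ℂ m)} {R : Set (PSpace ℝ m)}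
  {a b : PSpace ℂ m →₀ ℂ} {r : PSpace ℝ m →₀ ℝ}

/-- The real form that the real decomposition yields on `Z`. -/
noncomputable def partForm (d : ℕ) (r : PSpace ℝ m →₀ ℝ) (Z : Set (PSpace ℂ m)) : Form ℝ m d :=
  Finsupp.linearCombination ℝ (powRep d) (r.filter (· ∈ toC ⁻¹' Z))

namespace Decompositions

lemma finite_image (D : Decompositions p A R a b r) : (toC '' R).Finite := D.minR.1.image _

lemma relation (D : Decompositions p A R a b r) :
    Finsupp.linearCombination ℂ (powRep d) (a - b) = 0 := by
  have h1 := D.filterB Set.univ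
  have h2 : ∀ Z : Set (PSpace ℂ m), Z = Set.univ → b.filter (· ∈ Z) = b := fun Z hZ => by
    rw [Finsupp.filter_eq_self_iff]; simp [hZ]
  have h3 : ∀ Z : Set (PSpace ℝ m), Z = Set.univ → r.filter (· ∈ Z) = r := fun Z hZ => by
    rw [Finsupp.filter_eq_self_iff]; simp [hZ]
  rw [h2 _ rfl, h3 _ Set.preimage_univ, D.sumR] at h1
  rw [map_sub, D.sumA, h1, sub_self]

lemma support_subset (D : Decompositions p A R a b r) :
    ((a - b).support : Set (PSpace ℂ m)) ⊆ A ∪ toC '' R := by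
  rw [← D.suppA, ← D.suppB, ← Finset.coe_union]
  exact_mod_cast Finsupp.support_sub

lemma card_support_le (D : Decompositions p A R a b r) :
    (a - b).support.card ≤ A.ncard + R.ncard := by
  rw [← Set.ncard_coe_finset]
  refine (Set.ncard_le_ncard D.support_subset (D.minA.1.union D.finite_image)).trans ?_
  refine (Set.ncard_union_le _ _).trans ?_
  rw [Set.ncard_image_of_injective _ toC_injective]

lemma mem_iff (D : Decompositions p A R a b r) {x : PSpace ℂ m} (hx : x ∉ (a - b).support) :
    x ∈ A ↔ x ∈ toC '' R := by
  have h : a x = b x := by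
    simpa [sub_eq_zero] using hx
  rw [← D.suppA, ← D.suppB, Finset.mem_coe, Finset.mem_coe, Finsupp.mem_support_iff,
    Finsupp.mem_support_iff, h]

lemma sdiff_eq (D : Decompositions p A R a b r) {Z : Set (PSpace ℂ m)}
    (hZ : ((a - b).support : Set (PSpace ℂ m)) ⊆ Z) : A \ Z = toC '' R \ Z := by
  ext x
  simp only [Set.mem_sdiff]
  exact and_congr_left fun hx => D.mem_iff fun h => hx (hZ h)

lemma filter_relation (D : Decompositions p A R a b r) {Z : Set (PSpace ℂ m)}
    (hZ : ((a - b).support : Set (PSpace ℂ m)) ⊆ Z) :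
    Finsupp.linearCombination ℂ (powRep d) ((a - b).filter (· ∈ Z)) = 0 := by
  have h : (a - b).filter (· ∈ Z) = a - b := by
    rw [Finsupp.filter_eq_self_iff]
    intro x hx
    exact hZ (Finsupp.mem_support_iff.2 hx)
  rw [h, D.relation]

lemma ncard_inter_lt (D : Decompositions p A R a b r) (hlt : A.ncard < R.ncard)
    {Z : Set (PSpace ℂ m)} (hZ : A \ Z = toC '' R \ Z) :
    (A ∩ Z).ncard < (toC '' R ∩ Z).ncard := by
  have h1 := Set.ncard_inter_add_ncard_sdiff_eq_ncard A Z D.minA.1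
  have h2 := Set.ncard_inter_add_ncard_sdiff_eq_ncard (toC '' R) Z D.finite_image
  rw [Set.ncard_image_of_injective _ toC_injective] at h2
  rw [hZ] at h1
  omega

lemma support_inter_subset (D : Decompositions p A R a b r) (Z : Set (PSpace ℂ m)) :
    ((a - b).support : Set (PSpace ℂ m)) ∩ Z ⊆ (A ∪ toC '' R) ∩ Z :=
  Set.inter_subset_inter_left _ D.support_subset

lemma ncard_support_inter_le (D : Decompositions p A R a b r) (Z : Set (PSpace ℂ m)) :
    (((a - b).support : Set (PSpace ℂ m)) ∩ Z).ncard ≤ ((A ∪ toC '' R) ∩ Z).ncard :=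
  Set.ncard_le_ncard (D.support_inter_subset Z)
    ((D.minA.1.union D.finite_image).subset Set.inter_subset_left)

lemma ncard_support_inter_le_add (D : Decompositions p A R a b r) (Z : Set (PSpace ℂ m)) :
    (((a - b).support : Set (PSpace ℂ m)) ∩ Z).ncard ≤ (A ∩ Z).ncard + (toC '' R ∩ Z).ncard := by
  refine (D.ncard_support_inter_le Z).trans ?_
  rw [Set.union_inter_distrib_right]
  exact Set.ncard_union_le _ _

/-- If the relation between the two decompositions restricts to `Z`, so do the decompositions. -/
lemma restrict (D : Decompositions p A R a b r) {Z : Set (PSpace ℂ m)}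
    (hrel : Finsupp.linearCombination ℂ (powRep d) ((a - b).filter (· ∈ Z)) = 0) :
    formToComplex (partForm d r Z) = Finsupp.linearCombination ℂ (powRep d) (a.filter (· ∈ Z)) ∧
      IsMinimal d (A ∩ Z) (formToComplex (partForm d r Z)) ∧
      IsMinimal d (R ∩ toC ⁻¹' Z) (partForm d r Z) ∧
      formToComplex (partForm d r Z) ∈ verSub d (toC '' R ∩ Z) := by
  have h1 : formToComplex (partForm d r Z) =
      Finsupp.linearCombination ℂ (powRep d) (a.filter (· ∈ Z)) := by
    rw [partForm, ← D.filterB, eq_comm, ← sub_eq_zero, ← map_sub, ← hrel]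
    congr 1
    ext x
    by_cases hx : x ∈ Z <;> simp [hx]
  refine ⟨h1, ?_, ?_, ?_⟩
  · rw [h1]
    exact D.minA.inter D.suppA D.sumA Z
  · exact D.minR.inter D.suppR D.sumR _
  · rw [partForm, ← D.filterB, ← D.suppB]
    exact linearCombination_filter_mem b Z

lemma ncard_inter_le (D : Decompositions p A R a b r) {Z : Set (PSpace ℂ m)}
    (hrel : Finsupp.linearCombination ℂ (powRep d) ((a - b).filter (· ∈ Z)) = 0) :
    (A ∩ Z).ncard ≤ (toC '' R ∩ Z).ncard :=
  (D.restrict hrel).2.1.2.2 _ (D.finite_image.subset Set.inter_subset_left) (D.restrict hrel).2.2.2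

lemma partForm_ne_zero (D : Decompositions p A R a b r) {Z : Set (PSpace ℂ m)}
    (hrel : Finsupp.linearCombination ℂ (powRep d) ((a - b).filter (· ∈ Z)) = 0)
    (hne : (((a - b).support : Set (PSpace ℂ m)) ∩ Z).Nonempty) : partForm d r Z ≠ 0 := by
  obtain ⟨x, hx⟩ := hne
  rcases D.support_inter_subset Z hx with ⟨hxA | ⟨s, hs, rfl⟩, hxZ⟩
  · exact fun h => (D.restrict hrel).2.1.ne_zero ⟨x, hxA, hxZ⟩ (by rw [h, map_zero])
  · exact (D.restrict hrel).2.2.1.ne_zero ⟨s, hs, hxZ⟩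

lemma evincesBothOn (D : Decompositions p A R a b r) {Z : Set (PSpace ℂ m)}
    (hrel : Finsupp.linearCombination ℂ (powRep d) ((a - b).filter (· ∈ Z)) = 0)
    (h0 : partForm d r Z ≠ 0) :
    EvincesBothOn d A R Z (Projectivization.mk ℝ (partForm d r Z) h0) := by
  refine ⟨?_, (evinces_mk_iff h0).2 (D.restrict hrel).2.2.1⟩
  rw [formToC_mk]
  exact (evinces_mk_iff _).2 (D.restrict hrel).2.1

lemma exists_point (D : Decompositions p A R a b r) {Z : Set (PSpace ℂ m)}
    (hrel : Finsupp.linearCombination ℂ (powRep d) ((a - b).filter (· ∈ Z)) = 0)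
    (hne : (((a - b).support : Set (PSpace ℂ m)) ∩ Z).Nonempty) :
    ∃ Q : FormSpace ℝ m d, formToC Q ∈ verSpan d (A ∩ Z) ∧
      formToC Q ∈ verSpan d (toC '' R ∩ Z) ∧ EvincesBothOn d A R Z Q := by
  have h0 := D.partForm_ne_zero hrel hne
  refine ⟨Projectivization.mk ℝ _ h0, ?_, ?_, D.evincesBothOn hrel h0⟩
  · rw [formToC_mk, mk_mem_verSpan]
    exact (D.restrict hrel).2.1.2.1
  · rw [formToC_mk, mk_mem_verSpan]
    exact (D.restrict hrel).2.2.2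

lemma cayleyBacharach (D : Decompositions p A R a b r) :
    CayleyBacharach d (repSet (a - b).support) :=
  cayleyBacharach_support D.relation

end Decompositions

end Comparison

/-! ### Real lines and real zero loci -/

section Real

variable {m : ℕ}

lemma DefinedOverReal.inter {Z Z' : Set (PSpace ℂ m)} (h : DefinedOverReal Z)
    (h' : DefinedOverReal Z') : DefinedOverReal (Z ∩ Z') := by
  obtain ⟨F, hF, rfl⟩ := h
  obtain ⟨F', hF', rfl⟩ := h'
  refine ⟨F ∪ F', ?_, ?_⟩
  · rintro f (hf | hf)
    exacts [hF f hf, hF' f hf]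
  · ext x
    simp only [Set.mem_inter_iff, Set.mem_ofPred_eq, Set.mem_union]
    exact ⟨fun h f hf => hf.elim (h.1 f) (h.2 f), fun h => ⟨fun f hf => h f (Or.inl hf),
      fun f hf => h f (Or.inr hf)⟩⟩

lemma DefinedOverReal.union {Z Z' : Set (PSpace ℂ m)} (h : DefinedOverReal Z)
    (h' : DefinedOverReal Z') : DefinedOverReal (Z ∪ Z') := by
  obtain ⟨F, hF, rfl⟩ := h
  obtain ⟨F', hF', rfl⟩ := h'
  refine ⟨Set.image2 (· * ·) F F', ?_, ?_⟩
  · rintro _ ⟨f, hf, g, hg, rfl⟩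
    obtain ⟨k, hk⟩ := hF f hf
    obtain ⟨l, hl⟩ := hF' g hg
    exact ⟨k + l, hk.mul hl⟩
  · ext x
    simp only [Set.mem_union, Set.mem_ofPred_eq]
    constructor
    · rintro (h | h) _ ⟨f, hf, g, hg, rfl⟩
      · simp [h f hf]
      · simp [h g hg]
    · intro h
      by_contra! hcon
      obtain ⟨⟨f, hf, hfx⟩, ⟨g, hg, hgx⟩⟩ := hcon
      have := h _ ⟨f, hf, g, hg, rfl⟩
      rw [map_mul] at this
      exact (mul_ne_zero hfx hgx) this

lemma definedOverReal_zeroLocus {f : MvPolynomial (Fin (m + 1)) ℝ} {k : ℕ}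
    (hf : f.IsHomogeneous k) : DefinedOverReal {x : PSpace ℂ m | aeval x.rep f = 0} :=
  ⟨{f}, by rintro _ rfl; exact ⟨k, hf⟩, by simp⟩

/-- The complex span of a real subspace. -/
noncomputable def complexSpan (U : Submodule ℝ (Fin (m + 1) → ℝ)) :
    Submodule ℂ (Fin (m + 1) → ℂ) :=
  Submodule.span ℂ (vecToComplex '' U)

lemma aeval_dualPoly_add (f : Module.Dual ℝ (Fin (m + 1) → ℝ)) (x y : Fin (m + 1) → ℂ) :
    aeval (x + y) (dualPoly f) = aeval x (dualPoly f) + aeval y (dualPoly f) := by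
  simp [dualPoly, mul_add, Finset.sum_add_distrib]

lemma aeval_dualPoly_smul (f : Module.Dual ℝ (Fin (m + 1) → ℝ)) (t : ℂ) (x : Fin (m + 1) → ℂ) :
    aeval (t • x) (dualPoly f) = t * aeval x (dualPoly f) := by
  simp [dualPoly, Finset.mul_sum, mul_left_comm]

lemma aeval_vecToComplex (F : MvPolynomial (Fin (m + 1)) ℝ) (v : Fin (m + 1) → ℝ) :
    aeval (vecToComplex v) F = ((eval v F : ℝ) : ℂ) := by
  have h : (vecToComplex v : Fin (m + 1) → ℂ) = algebraMap ℝ ℂ ∘ v := rfl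
  rw [h, aeval_algebraMap_apply, aeval_eq_eval]
  rfl

lemma mem_complexSpan_iff {U : Submodule ℝ (Fin (m + 1) → ℝ)} {x : Fin (m + 1) → ℂ} :
    x ∈ complexSpan U ↔
      ∀ f : Module.Dual ℝ (Fin (m + 1) → ℝ), U ≤ LinearMap.ker f → aeval x (dualPoly f) = 0 := by
  constructor
  · intro hx f hf
    induction hx using Submodule.span_induction with
    | mem x hx =>
      obtain ⟨u, hu, rfl⟩ := hx
      rw [aeval_vecToComplex, eval_dualPoly, show f u = 0 from hf hu, Complex.ofReal_zero]
    | zero => simp [dualPoly]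
    | add x y _ _ h1 h2 => rw [aeval_dualPoly_add, h1, h2, add_zero]
    | smul t x _ h => rw [aeval_dualPoly_smul, h, mul_zero]
  · intro h
    have hx : x =
        vecToComplex (fun i => (x i).re) + Complex.I • vecToComplex fun i => (x i).im := by
      ext i
      change x i = ((x i).re : ℂ) + Complex.I * ((x i).im : ℂ)
      rw [mul_comm, Complex.re_add_im]
    have key : ∀ f : Module.Dual ℝ (Fin (m + 1) → ℝ), U ≤ LinearMap.ker f →
        f (fun i => (x i).re) = 0 ∧ f (fun i => (x i).im) = 0 := by
      intro f hf
      have h1 := h f hf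
      rw [hx, aeval_dualPoly_add, aeval_dualPoly_smul, aeval_vecToComplex, aeval_vecToComplex,
        eval_dualPoly, eval_dualPoly, mul_comm] at h1
      have h2 := congrArg Complex.re h1
      have h3 := congrArg Complex.im h1
      simp at h2 h3
      exact ⟨h2, h3⟩
    have hmem : ∀ v : Fin (m + 1) → ℝ,
        (∀ f : Module.Dual ℝ (Fin (m + 1) → ℝ), U ≤ LinearMap.ker f → f v = 0) →
        vecToComplex v ∈ complexSpan U := by
      intro v hv
      refine Submodule.subset_span ⟨v, ?_, rfl⟩
      by_contra hvU
      obtain ⟨f, hfv, hf⟩ := Submodule.exists_le_ker_of_notMem hvU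
      exact hfv (hv f hf)
    rw [hx]
    exact Submodule.add_mem _ (hmem _ fun f hf => (key f hf).1)
      (Submodule.smul_mem _ _ (hmem _ fun f hf => (key f hf).2))

lemma definedOverReal_complexSpan (U : Submodule ℝ (Fin (m + 1) → ℝ)) :
    DefinedOverReal ((complexSpan U).projectivization : Set (PSpace ℂ m)) := by
  refine ⟨{F | ∃ f : Module.Dual ℝ (Fin (m + 1) → ℝ), U ≤ LinearMap.ker f ∧ dualPoly f = F}, ?_, ?_⟩
  · rintro _ ⟨f, -, rfl⟩
    exact ⟨1, dualPoly_isHomogeneous f⟩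
  · ext x
    rw [SetLike.mem_coe, mem_projectivization_iff, mem_complexSpan_iff]
    simp

lemma complexSpan_le_iff {U : Submodule ℝ (Fin (m + 1) → ℝ)} {W : Submodule ℂ (Fin (m + 1) → ℂ)} :
    complexSpan U ≤ W ↔ ∀ u ∈ U, vecToComplex u ∈ W := by
  rw [complexSpan, Submodule.span_le, Set.image_subset_iff]
  rfl

/-- The real vectors of a complex subspace. -/
noncomputable def realPart (W : Submodule ℂ (Fin (m + 1) → ℂ)) : Submodule ℝ (Fin (m + 1) → ℝ) where
  carrier := {u | vecToComplex u ∈ W}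
  add_mem' {u v} hu hv := by
    change vecToComplex (u + v) ∈ W
    rw [map_add]
    exact W.add_mem hu hv
  zero_mem' := by
    change vecToComplex 0 ∈ W
    rw [map_zero]
    exact W.zero_mem
  smul_mem' t u hu := by
    change vecToComplex (t • u) ∈ W
    rw [map_smulₛₗ]
    exact W.smul_mem _ hu

lemma two_le_finrank_of_points {K : Type} [Field K] {W : Submodule K (Fin (m + 1) → K)}
    {x y : PSpace K m} (hx : x ∈ W.projectivization) (hy : y ∈ W.projectivization) (hxy : x ≠ y) :
    2 ≤ Module.finrank K W :=
  two_le_finrank (mem_projectivization_iff.1 hx) (mem_projectivization_iff.1 hy) y.rep_nonzero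
    fun h => hxy (rep_mem_span_iff.1 h)

lemma toC_mem_complexSpan_realPart {W : Submodule ℂ (Fin (m + 1) → ℂ)} {s : PSpace ℝ m}
    (hs : toC s ∈ W.projectivization) : toC s ∈ (complexSpan (realPart W)).projectivization := by
  rw [toC_mem_projectivization] at hs ⊢
  exact Submodule.subset_span ⟨s.rep, hs, rfl⟩

lemma complexSpan_realPart_le (W : Submodule ℂ (Fin (m + 1) → ℂ)) : complexSpan (realPart W) ≤ W :=
  complexSpan_le_iff.2 fun _ hu => hu

/-- A line with two real points is real. -/
lemma definedOverReal_of_two_points {W : Submodule ℂ (Fin (m + 1) → ℂ)}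
    (hW : Module.finrank ℂ W = 2) {s t : PSpace ℝ m} (hst : s ≠ t)
    (hs : toC s ∈ W.projectivization) (ht : toC t ∈ W.projectivization) :
    DefinedOverReal (W.projectivization : Set (PSpace ℂ m)) := by
  have h : complexSpan (realPart W) = W := by
    refine Submodule.eq_of_le_of_finrank_le (complexSpan_realPart_le W) ?_
    rw [hW]
    exact two_le_finrank_of_points (toC_mem_complexSpan_realPart hs)
      (toC_mem_complexSpan_realPart ht) (toC_injective.ne hst)
  rw [← h]
  exact definedOverReal_complexSpan _

lemma definedOverReal_of_two_le_ncard {W : Submodule ℂ (Fin (m + 1) → ℂ)}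
    (hW : Module.finrank ℂ W = 2) {R : Set (PSpace ℝ m)} (hR : R.Finite)
    (h : 2 ≤ (toC '' R ∩ (W.projectivization : Set (PSpace ℂ m))).ncard) :
    DefinedOverReal (W.projectivization : Set (PSpace ℂ m)) := by
  obtain ⟨_, ⟨⟨s, -, rfl⟩, hs⟩, _, ⟨⟨t, -, rfl⟩, ht⟩, hst⟩ :=
    (Set.one_lt_ncard ((hR.image toC).subset Set.inter_subset_left)).1 h
  exact definedOverReal_of_two_points hW (fun h => hst (by rw [h])) hs ht

end Real

/-! ### Quadratic forms on planes, and lines in them -/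

section Quadrics

variable {K : Type} [Field K] {n : ℕ}

lemma finrank_inf_ker {W : Submodule K (Fin n → K)} {h : Module.Dual K (Fin n → K)}
    (hW : ∃ w ∈ W, h w ≠ 0) :
    Module.finrank K (W ⊓ LinearMap.ker h : Submodule K (Fin n → K)) + 1 = Module.finrank K W := by
  obtain ⟨w, hw, hhw⟩ := hW
  have h0 : h ∘ₗ W.subtype ≠ 0 := fun h0 => hhw (LinearMap.congr_fun h0 ⟨w, hw⟩)
  rw [← Module.Dual.finrank_ker_add_one_of_ne_zero h0, LinearMap.ker_comp,
    ← Submodule.map_comap_subtype, Submodule.finrank_map_subtype_eq]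

/-- A quadratic form that vanishes on a hyperplane `L` of `W` is, on `W`, the product of an equation
of `L` and another linear form. -/
lemma exists_linear_factors {W L : Submodule K (Fin n → K)} (hLW : L ≤ W)
    (hfin : Module.finrank K W = Module.finrank K L + 1) {q : QuadraticForm K (Fin n → K)}
    (hq : ∀ v ∈ L, q v = 0) :
    ∃ γ h : Module.Dual K (Fin n → K), (∀ w ∈ W, q w = γ w * h w) ∧ (∀ w ∈ W, γ w = 0 → w ∈ L) ∧
      ∀ w ∈ L, γ w = 0 := by
  obtain ⟨z, hz, hzL⟩ : ∃ z ∈ W, z ∉ L := by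
    by_contra! h
    have := Submodule.finrank_mono (show W ≤ L from h)
    omega
  obtain ⟨γ₀, hγ₀z, hγ₀⟩ := Submodule.exists_le_ker_of_notMem hzL
  set γ := (γ₀ z)⁻¹ • γ₀ with hγ
  have hγz : γ z = 1 := by simp [hγ, hγ₀z]
  have hγL : ∀ w ∈ L, γ w = 0 := fun w hw => by
    have : γ₀ w = 0 := hγ₀ hw
    simp [hγ, this]
  have hL : W ⊓ LinearMap.ker γ = L := by
    have hle : L ≤ W ⊓ LinearMap.ker γ := fun v hv => Submodule.mem_inf.2 ⟨hLW hv, hγL v hv⟩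
    refine (Submodule.eq_of_le_of_finrank_le hle ?_).symm
    have := finrank_inf_ker (h := γ) ⟨z, hz, by rw [hγz]; exact one_ne_zero⟩
    omega
  have hkerL : ∀ w ∈ W, γ w = 0 → w ∈ L := fun w hw h0 => hL ▸ ⟨hw, h0⟩
  refine ⟨γ, q z • γ + (q.polarBilin.flip z) ∘ₗ (LinearMap.id - γ.smulRight z), fun w hw => ?_,
    hkerL, hγL⟩
  have hl : w - γ w • z ∈ L :=
    hkerL _ (W.sub_mem hw (W.smul_mem _ hz)) (by simp [hγz])
  have hsplit : w = (w - γ w • z) + γ w • z := by simp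
  conv_lhs => rw [hsplit]
  rw [QuadraticMap.map_add q, hq _ hl, QuadraticMap.map_smul, QuadraticMap.polar_smul_right]
  simp only [LinearMap.add_apply, LinearMap.smul_apply, LinearMap.comp_apply, LinearMap.flip_apply,
    LinearMap.sub_apply, LinearMap.id_apply, LinearMap.smulRight_apply,
    QuadraticMap.polarBilin_apply_apply, smul_eq_mul]
  ring

/-- A quadratic form with three zeros on a line vanishes on the line. -/
lemma eq_zero_on_line {L : Submodule K (Fin n → K)} (hL : Module.finrank K L = 2)
    {r : QuadraticForm K (Fin n → K)} {x y z : Fin n → K} (hx : x ∈ L) (hy : y ∈ L) (hz : z ∈ L)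
    (hy0 : y ≠ 0) (hxy : x ∉ Submodule.span K {y}) (hzx : z ∉ Submodule.span K {x})
    (hzy : z ∉ Submodule.span K {y}) (hrx : r x = 0) (hry : r y = 0) (hrz : r z = 0) :
    ∀ v ∈ L, r v = 0 := by
  have hspan : Submodule.span K ({x, y} : Set (Fin n → K)) = L := by
    refine Submodule.eq_of_le_of_finrank_le ?_ ?_
    · rw [Submodule.span_le]
      rintro v (rfl | rfl)
      exacts [hx, hy]
    · rw [hL]
      exact two_le_finrank (Submodule.subset_span (by simp)) (Submodule.subset_span (by simp))
        hy0 hxy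
  have expand : ∀ α β : K, r (α • x + β • y) = α * β * QuadraticMap.polar r x y := by
    intro α β
    rw [QuadraticMap.map_add r, QuadraticMap.map_smul, QuadraticMap.map_smul,
      QuadraticMap.polar_smul_left, QuadraticMap.polar_smul_right, hrx, hry]
    simp only [smul_eq_mul]
    ring
  obtain ⟨α, β, rfl⟩ := Submodule.mem_span_pair.1 (hspan ▸ hz)
  have hα : α ≠ 0 := by
    rintro rfl
    exact hzy (Submodule.mem_span_singleton.2 ⟨β, by simp⟩)
  have hβ : β ≠ 0 := by
    rintro rfl
    exact hzx (Submodule.mem_span_singleton.2 ⟨α, by simp⟩)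
  have hpol : QuadraticMap.polar r x y = 0 := by
    rw [expand] at hrz
    exact (mul_eq_zero.1 hrz).resolve_left (mul_ne_zero hα hβ)
  intro v hv
  obtain ⟨α', β', rfl⟩ := Submodule.mem_span_pair.1 (hspan ▸ hv)
  rw [expand, hpol, mul_zero]

lemma PairwiseIndep.notMem_span {T : Finset (Fin n → K)} (hi : PairwiseIndep T) {x y : Fin n → K}
    (hx : x ∈ T) (hy : y ∈ T) (hxy : x ≠ y) : x ∉ Submodule.span K {y} :=
  fun h => hxy ((hi x hx).2 y hy h)

/-- A plane conic that contains no line has at most two points on a line. -/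
lemma card_inter_line_le_two {W L : Submodule K (Fin n → K)} {q : QuadraticForm K (Fin n → K)}
    (hirr : ∀ L ≤ W, Module.finrank K L = 2 → ∃ w ∈ L, q w ≠ 0) (hLW : L ≤ W)
    (hL : Module.finrank K L = 2) {T : Finset (Fin n → K)} (hi : PairwiseIndep T)
    (hq : ∀ x ∈ T, q x = 0) (hTL : ∀ x ∈ T, x ∈ L) : T.card ≤ 2 := by
  by_contra! h
  obtain ⟨x, y, z, hx, hy, hz, hxy, hxz, hyz⟩ := Finset.two_lt_card_iff.1 h
  obtain ⟨w, hw, hqw⟩ := hirr L hLW hL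
  exact hqw (eq_zero_on_line hL (hTL x hx) (hTL y hy) (hTL z hz) (hi y hy).1
    (hi.notMem_span hx hy hxy) (hi.notMem_span hz hx hxz.symm) (hi.notMem_span hz hy hyz.symm)
    (hq x hx) (hq y hy) (hq z hz) w hw)

/-- A plane conic that contains no line is determined by five of its points. -/
lemma conic_unique {W : Submodule K (Fin n → K)} (hW : Module.finrank K W = 3)
    {q q' : QuadraticForm K (Fin n → K)}
    (hirr : ∀ L ≤ W, Module.finrank K L = 2 → ∃ w ∈ L, q w ≠ 0) {T : Finset (Fin n → K)}
    (hi : PairwiseIndep T) (hc : T.card = 5) (hTW : ∀ x ∈ T, x ∈ W) (hq : ∀ x ∈ T, q x = 0)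
    (hq' : ∀ x ∈ T, q' x = 0) : ∃ κ : K, ∀ w ∈ W, q' w = κ * q w := by
  obtain ⟨x, hx, y, hy, hxy⟩ := Finset.one_lt_card.1 (by omega : 1 < T.card)
  set L := Submodule.span K ({x, y} : Set (Fin n → K)) with hLdef
  have hxL : x ∈ L := Submodule.subset_span (by simp)
  have hyL : y ∈ L := Submodule.subset_span (by simp)
  have hL : Module.finrank K L = 2 := le_antisymm (finrank_span_pair_le x y)
    (two_le_finrank hxL hyL (hi y hy).1 (hi.notMem_span hx hy hxy))
  have hLW : L ≤ W := by
    rw [hLdef, Submodule.span_le]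
    rintro v (rfl | rfl)
    exacts [hTW _ hx, hTW _ hy]
  have hzx : x + y ∉ Submodule.span K {x} := fun h =>
    hi.notMem_span hy hx hxy.symm
      ((Submodule.add_mem_iff_right _ (Submodule.mem_span_singleton_self x)).1 h)
  have hzy : x + y ∉ Submodule.span K {y} := fun h =>
    hi.notMem_span hx hy hxy
      ((Submodule.add_mem_iff_left _ (Submodule.mem_span_singleton_self y)).1 h)
  have hqz : q (x + y) ≠ 0 := by
    intro h0
    obtain ⟨w, hw, hqw⟩ := hirr L hLW hL
    exact hqw (eq_zero_on_line hL hxL hyL (L.add_mem hxL hyL) (hi y hy).1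
      (hi.notMem_span hx hy hxy) hzx hzy (hq x hx) (hq y hy) h0 w hw)
  -- The member of the pencil through the further point `x + y` of the line contains the line.
  set κ := q' (x + y) / q (x + y) with hκ
  set r := q' - κ • q with hr
  have hrT : ∀ v ∈ T, r v = 0 := fun v hv => by simp [hr, hq v hv, hq' v hv]
  have hrL : ∀ v ∈ L, r v = 0 :=
    eq_zero_on_line hL hxL hyL (L.add_mem hxL hyL) (hi y hy).1 (hi.notMem_span hx hy hxy) hzx hzy
      (hrT x hx) (hrT y hy) (by simp [hr, hκ, hqz])
  obtain ⟨γ, h, hγh, hγ, -⟩ := exists_linear_factors hLW (by omega) hrL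
  refine ⟨κ, fun w hw => ?_⟩
  suffices hh : ∀ w ∈ W, h w = 0 by
    have h1 := hγh w hw
    rw [hh w hw, mul_zero] at h1
    simpa [hr, sub_eq_zero] using h1
  by_contra! hne
  have hline := finrank_inf_ker hne
  have h1 : (T.filter fun v => v ∈ L).card ≤ 2 :=
    card_inter_line_le_two hirr hLW hL (hi.mono (Finset.filter_subset _ _))
      (fun v hv => hq v (Finset.mem_filter.1 hv).1) fun v hv => (Finset.mem_filter.1 hv).2
  have h2 : (T.filter fun v => v ∉ L).card ≤ 2 := by
    refine card_inter_line_le_two (L := W ⊓ LinearMap.ker h) hirr inf_le_left (by omega)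
      (hi.mono (Finset.filter_subset _ _)) (fun v hv => hq v (Finset.mem_filter.1 hv).1)
      fun v hv => ?_
    rw [Finset.mem_filter] at hv
    have h3 := hγh v (hTW v hv.1)
    rw [hrT v hv.1, eq_comm, mul_eq_zero] at h3
    exact ⟨hTW v hv.1, h3.resolve_left fun h0 => hv.2 (hγ v (hTW v hv.1) h0)⟩
  have h3 := Finset.card_filter_add_card_filter_not (s := T) (fun v => v ∈ L)
  omega

/-- For two lines that meet in a point there is a linear map that fixes the second line pointwise
and contracts the first one to the common point. -/
lemma exists_contraction {W W' : Submodule K (Fin n → K)} (hW : Module.finrank K W = 2)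
    (hW' : Module.finrank K W' = 2) (hne : W ≠ W') (hd : ¬ Disjoint W W') :
    ∃ π : (Fin n → K) →ₗ[K] (Fin n → K), (∀ v ∈ W', π v = v) ∧ ∀ v ∈ W, π v ∈ W ⊓ W' := by
  obtain ⟨u, hu, huW'⟩ := exists_mem_notMem_of_finrank (hW.trans hW'.symm) hne
  obtain ⟨f, hfu, hf⟩ := Submodule.exists_le_ker_of_notMem huW'
  have hinf : W ⊓ W' = W ⊓ LinearMap.ker f := by
    refine Submodule.eq_of_le_of_finrank_le (inf_le_inf_left _ hf) ?_
    have h1 := finrank_inf_ker (W := W) ⟨u, hu, hfu⟩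
    have h2 : 0 < Module.finrank K (W ⊓ W' : Submodule K (Fin n → K)) := by
      rw [Module.finrank_pos_iff, Submodule.nontrivial_iff_ne_bot]
      rwa [disjoint_iff] at hd
    omega
  refine ⟨LinearMap.id - (((f u)⁻¹ • f).smulRight u), fun v hv => ?_, fun v hv => ?_⟩
  · have : f v = 0 := hf hv
    simp [this]
  · rw [hinf]
    refine ⟨W.sub_mem hv (W.smul_mem _ hu), ?_⟩
    rw [SetLike.mem_coe, LinearMap.mem_ker]
    simp only [LinearMap.sub_apply, LinearMap.id_apply, LinearMap.smulRight_apply,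
      LinearMap.smul_apply, map_sub, map_smul, smul_eq_mul]
    field_simp
    ring

/-- For two disjoint lines there is a linear map that fixes the first line pointwise and kills the
second one. -/
lemma exists_projection {W W' : Submodule K (Fin n → K)} (hd : Disjoint W W') :
    ∃ π : (Fin n → K) →ₗ[K] (Fin n → K), (∀ v ∈ W, π v = v) ∧ ∀ v ∈ W', π v = 0 := by
  obtain ⟨E, hE, hEW⟩ := hd.symm.exists_isCompl
  refine ⟨W.subtype ∘ₗ W.projectionOnto E hEW.symm, fun v hv => ?_, fun v hv => ?_⟩
  · exact congrArg W.subtype (Submodule.projectionOnto_apply_left hEW.symm ⟨v, hv⟩)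
  · simpa using hE hv

end Quadrics

/-! ### Real conics -/

section RealConics

variable {m : ℕ}

lemma finrank_complexSpan_le (U : Submodule ℝ (Fin (m + 1) → ℝ)) :
    Module.finrank ℂ (complexSpan U) ≤ Module.finrank ℝ U := by
  let b := Module.finBasis ℝ U
  have h : complexSpan U ≤
      Submodule.span ℂ (Set.range fun i => vecToComplex ((b i : U) : Fin (m + 1) → ℝ)) := by
    refine complexSpan_le_iff.2 fun u hu => ?_
    have h1 : u = ∑ i, b.repr ⟨u, hu⟩ i • ((b i : U) : Fin (m + 1) → ℝ) := by
      have := congrArg U.subtype (b.sum_repr ⟨u, hu⟩)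
      rw [map_sum] at this
      exact this.symm
    rw [h1, map_sum]
    refine Submodule.sum_mem _ fun i _ => ?_
    rw [map_smulₛₗ]
    exact Submodule.smul_mem _ _ (Submodule.subset_span ⟨i, rfl⟩)
  refine (Submodule.finrank_mono h).trans ?_
  refine (finrank_range_le_card _).trans ?_
  simp

/-- A plane conic with five real points that contains no line is real. -/
lemma definedOverReal_conic {W : Submodule ℂ (Fin (m + 1) → ℂ)} (hW : Module.finrank ℂ W = 3)
    {q : QuadraticForm ℂ (Fin (m + 1) → ℂ)}
    (hirr : ∀ L ≤ W, Module.finrank ℂ L = 2 → ∃ w ∈ L, q w ≠ 0) {S : Finset (PSpace ℝ m)}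
    (hS : S.card = 5) (hSW : ∀ s ∈ S, toC s ∈ W.projectivization)
    (hSq : ∀ s ∈ S, q (toC s).rep = 0) :
    DefinedOverReal {x : PSpace ℂ m | x ∈ W.projectivization ∧ q x.rep = 0} := by
  have hline : ∀ L ≤ W, Module.finrank ℂ L = 2 → ∀ S' ⊆ S, (∀ s ∈ S', toC s ∈ L.projectivization) →
      S'.card ≤ 2 := by
    intro L hLW hL S' hS' hS'L
    have h := card_inter_line_le_two hirr hLW hL (pairwiseIndep_repSet (S'.image toC))
      (forall_mem_repSet.2 ?_) (forall_mem_repSet.2 ?_)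
    · rwa [card_repSet, Finset.card_image_of_injective _ toC_injective] at h
    · intro x hx
      obtain ⟨s, hs, rfl⟩ := Finset.mem_image.1 hx
      exact hSq s (hS' hs)
    · intro x hx
      obtain ⟨s, hs, rfl⟩ := Finset.mem_image.1 hx
      exact mem_projectivization_iff.1 (hS'L s hs)
  -- Three of the points span `W`, which is therefore real.
  obtain ⟨s₁, s₂, s₃, h₁, h₂, h₃, h12, h13, h23⟩ :=
    Finset.two_lt_card_iff.1 (by omega : 2 < S.card)
  set U : Submodule ℝ (Fin (m + 1) → ℝ) :=
    Submodule.span ℝ (({s₁.rep, s₂.rep, s₃.rep} : Finset (Fin (m + 1) → ℝ)) : Set _) with hUdef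
  have hU3 : Module.finrank ℝ U ≤ 3 :=
    (finrank_span_finset_le_card _).trans Finset.card_le_three
  have hmemU : ∀ s ∈ ({s₁, s₂, s₃} : Finset (PSpace ℝ m)), s.rep ∈ U := by
    intro s hs
    refine Submodule.subset_span ?_
    simp only [Finset.mem_insert, Finset.mem_singleton] at hs
    rcases hs with rfl | rfl | rfl <;> simp
  have hmemC : ∀ s ∈ ({s₁, s₂, s₃} : Finset (PSpace ℝ m)),
      toC s ∈ (complexSpan U).projectivization := fun s hs =>
    toC_mem_projectivization.2 (Submodule.subset_span ⟨s.rep, hmemU s hs, rfl⟩)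
  have hUW : complexSpan U ≤ W := by
    have h : U ≤ realPart W := by
      rw [hUdef, Submodule.span_le]
      intro v hv
      simp only [Finset.coe_insert, Finset.coe_singleton, Set.mem_insert_iff,
        Set.mem_singleton_iff] at hv
      rcases hv with rfl | rfl | rfl
      exacts [toC_mem_projectivization.1 (hSW _ h₁), toC_mem_projectivization.1 (hSW _ h₂),
        toC_mem_projectivization.1 (hSW _ h₃)]
    exact complexSpan_le_iff.2 fun u hu => h hu
  have hspan : complexSpan U = W := by
    refine Submodule.eq_of_le_of_finrank_le hUW ?_
    have h2 : 2 ≤ Module.finrank ℂ (complexSpan U) :=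
      two_le_finrank_of_points (hmemC s₁ (by simp)) (hmemC s₂ (by simp)) (toC_injective.ne h12)
    have h3 : Module.finrank ℂ (complexSpan U) ≠ 2 := by
      intro h2
      have h3 := hline _ hUW h2 {s₁, s₂, s₃} (by
        intro s hs
        simp only [Finset.mem_insert, Finset.mem_singleton] at hs
        rcases hs with rfl | rfl | rfl <;> assumption) hmemC
      rw [Finset.card_eq_three.2 ⟨s₁, s₂, s₃, h12, h13, h23, rfl⟩] at h3
      omega
    omega
  have hU : Module.finrank ℝ U = 3 := by
    have := finrank_complexSpan_le U
    rw [hspan, hW] at this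
    omega
  -- A real conic through the five points.
  obtain ⟨φ, -, hsurj⟩ := exists_coordinates hU
  obtain ⟨F, hF, hF0, hFS⟩ := exists_form_ne_zero (K := ℝ) (d := 2)
    (T := S.image fun s => φ s.rep) (by
      have := Finset.card_image_le (s := S) (f := fun s => φ s.rep)
      omega)
  obtain ⟨F', hF', hFF'⟩ := exists_pullback φ hF
  obtain ⟨q', hq'⟩ := exists_quadraticForm (hF'.map (algebraMap ℝ ℂ))
  have hq'a : ∀ v, q' v = aeval v F' := fun v => by
    rw [hq', eval_map, aeval_def]
  have hq'S : ∀ s ∈ S, q' (toC s).rep = 0 := by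
    intro s hs
    obtain ⟨u, hu⟩ := Projectivization.exists_smul_eq_mk_rep ℂ (vecToComplex s.rep)
      ((map_ne_zero_iff _ vecToComplex_injective).2 s.rep_nonzero)
    rw [← toC_eq_mk] at hu
    rw [← hu, Units.smul_def, QuadraticMap.map_smul, hq'a, aeval_vecToComplex, hFF',
      hFS _ (Finset.mem_image_of_mem _ hs), Complex.ofReal_zero, smul_zero]
  obtain ⟨κ, hκ⟩ := conic_unique hW (q' := q') hirr (pairwiseIndep_repSet (S.image toC))
    (by rw [card_repSet, Finset.card_image_of_injective _ toC_injective, hS])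
    (forall_mem_repSet.2 fun x hx => by
      obtain ⟨s, hs, rfl⟩ := Finset.mem_image.1 hx
      exact mem_projectivization_iff.1 (hSW s hs))
    (forall_mem_repSet.2 fun x hx => by
      obtain ⟨s, hs, rfl⟩ := Finset.mem_image.1 hx
      exact hSq s hs)
    (forall_mem_repSet.2 fun x hx => by
      obtain ⟨s, hs, rfl⟩ := Finset.mem_image.1 hx
      exact hq'S s hs)
  have hκ0 : κ ≠ 0 := by
    rintro rfl
    refine hF0 (hF.eq_zero_of_forall_eval_eq_zero fun y => ?_)
    obtain ⟨u, hu, rfl⟩ := hsurj y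
    have h1 := hκ (vecToComplex u) (hUW (Submodule.subset_span ⟨u, hu, rfl⟩))
    rw [zero_mul, hq'a, aeval_vecToComplex, Complex.ofReal_eq_zero] at h1
    rw [← hFF', h1]
  have hset : {x : PSpace ℂ m | x ∈ W.projectivization ∧ q x.rep = 0} =
      ((complexSpan U).projectivization : Set (PSpace ℂ m)) ∩ {x | aeval x.rep F' = 0} := by
    ext x
    rw [hspan]
    refine and_congr_right fun hx => ?_
    have h1 := hκ x.rep (mem_projectivization_iff.1 hx)
    rw [hq'a] at h1
    change _ ↔ aeval x.rep F' = 0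
    rw [h1, mul_eq_zero, or_iff_right hκ0]
  rw [hset]
  exact (definedOverReal_complexSpan U).inter (definedOverReal_zeroLocus hF')

end RealConics

/-! ### Relations supported on a line or on a plane conic -/

section Cases

variable {m d : ℕ} {p : Form ℝ m d} {A : Set (PSpace ℂ m)} {R : Set (PSpace ℝ m)}
  {a b : PSpace ℂ m →₀ ℂ} {r : PSpace ℝ m →₀ ℝ}

lemma CayleyBacharach.ncard_sdiff_ge {e : ℕ} {T : Finset (PSpace ℂ m)}
    (hT : CayleyBacharach (e + 1) (repSet T)) {W : Submodule ℂ (Fin (m + 1) → ℂ)}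
    (hne : ∃ x ∈ T, x ∉ W.projectivization) :
    e + 2 ≤ ((T : Set (PSpace ℂ m)) \ (W.projectivization : Set (PSpace ℂ m))).ncard := by
  obtain ⟨x, hx, hxW⟩ := hne
  have h1 := (hT.residual_submodule W).card_ge
    ((pairwiseIndep_repSet T).mono (Finset.filter_subset _ _))
    ⟨x.rep, Finset.mem_filter.2 ⟨Finset.mem_image_of_mem _ hx,
      fun h => hxW (mem_projectivization_iff.2 h)⟩⟩
  have h2 : (repSet T).filter (fun v => v ∉ W) =
      repSet (T.filter fun x => x ∉ W.projectivization) := by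
    rw [repSet, repSet, Finset.filter_image]
    congr 1
    exact Finset.filter_congr fun y _ => not_congr mem_projectivization_iff.symm
  rw [h2, card_repSet, ← Set.ncard_coe_finset] at h1
  convert h1 using 2
  ext y
  simp

namespace Decompositions

lemma support_nonempty (D : Decompositions p A R a b r) (hlt : A.ncard < R.ncard) :
    (a - b).support.Nonempty := by
  by_contra! h
  have hA : A = toC '' R := by
    ext x
    exact D.mem_iff (by simp [h])
  rw [hA, Set.ncard_image_of_injective _ toC_injective] at hlt
  exact lt_irrefl _ hlt

/-- The case in which the relation is supported on a line. -/
lemma lineCase (D : Decompositions p A R a b r) (hlt : A.ncard < R.ncard) (hd : 1 ≤ d)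
    {W : Submodule ℂ (Fin (m + 1) → ℂ)} (hW : Module.finrank ℂ W = 2)
    (hT : ∀ x ∈ (a - b).support, x ∈ W.projectivization) : LineCase d A R := by
  have hTW : ((a - b).support : Set (PSpace ℂ m)) ⊆ W.projectivization := hT
  have hne := D.support_nonempty hlt
  have hrel := D.filter_relation hTW
  have hcard := D.cayleyBacharach.card_ge (pairwiseIndep_repSet _) (hne.image _)
  rw [card_repSet] at hcard
  have hinter := Set.inter_eq_left.2 hTW
  have h1 := D.ncard_support_inter_le W.projectivization
  have h2 := D.ncard_support_inter_le_add W.projectivization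
  rw [hinter, Set.ncard_coe_finset] at h1 h2
  have h3 := D.ncard_inter_le hrel
  exact ⟨W.projectivization, ⟨W, hW, rfl⟩,
    definedOverReal_of_two_le_ncard hW D.minR.1 (by omega), D.sdiff_eq hTW,
    D.exists_point hrel (by rw [hinter]; exact hne), by omega,
    D.ncard_inter_lt hlt (D.sdiff_eq hTW)⟩

/-- If the relation is supported on two lines that meet in a point `Q`, then contracting the first
line to `Q` expresses the part of the complex decomposition on the second line through `Q` and
the real points of that line. -/
lemma ncard_inter_le_add_one (D : Decompositions p A R a b r)
    {W W' : Submodule ℂ (Fin (m + 1) → ℂ)} (hW : Module.finrank ℂ W = 2)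
    (hW' : Module.finrank ℂ W' = 2) (hne : W ≠ W') (hdis : ¬ Disjoint W W')
    (hT : ∀ x ∈ (a - b).support, x ∈ W.projectivization ∨ x ∈ W'.projectivization) :
    (A ∩ W'.projectivization).ncard ≤ (toC '' R ∩ W'.projectivization).ncard + 1 := by
  have hinf : Module.finrank ℂ (W ⊓ W' : Submodule ℂ (Fin (m + 1) → ℂ)) = 1 := by
    obtain ⟨u, hu, huW'⟩ := exists_mem_notMem_of_finrank (hW.trans hW'.symm) hne
    have h2 : 0 < Module.finrank ℂ (W ⊓ W' : Submodule ℂ (Fin (m + 1) → ℂ)) := by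
      rw [Module.finrank_pos_iff, Submodule.nontrivial_iff_ne_bot]
      rwa [disjoint_iff] at hdis
    have h3 : Module.finrank ℂ (W ⊓ W' : Submodule ℂ (Fin (m + 1) → ℂ)) < 2 := by
      rw [← hW]
      exact Submodule.finrank_lt_finrank_of_lt
        (lt_of_le_of_ne inf_le_left fun h => huW' ((inf_eq_left.1 h) hu))
    omega
  set Q : PSpace ℂ m := Projectivization.mk'' _ hinf with hQ
  have hQspan : W ⊓ W' = Submodule.span ℂ {Q.rep} := by
    rw [← Projectivization.submodule_eq, hQ, Projectivization.submodule_mk'']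
  obtain ⟨π, hπ', hπ⟩ := exists_contraction hW hW' hne hdis
  obtain ⟨σ, hσ⟩ := exists_substitution π d
  set Z : Set (PSpace ℂ m) := (W'.projectivization : Set (PSpace ℂ m)) with hZ
  have hpart : Finsupp.linearCombination ℂ (powRep d) ((a - b).filter (· ∈ Z)) ∈
      verSub d {Q} := by
    have h0 := congrArg σ D.relation
    rw [map_zero, ← Finsupp.filter_add_filter_not (a - b) (· ∈ Z), map_add, map_add] at h0
    have h1 : σ (Finsupp.linearCombination ℂ (powRep d) ((a - b).filter (· ∈ Z))) =
        Finsupp.linearCombination ℂ (powRep d) ((a - b).filter (· ∈ Z)) := by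
      rw [Finsupp.linearCombination_apply, Finsupp.sum, map_sum]
      refine Finset.sum_congr rfl fun x hx => ?_
      rw [Finsupp.support_filter, Finset.mem_filter] at hx
      rw [map_smul, powRep, hσ, hπ' _ (mem_projectivization_iff.1 hx.2)]
    have h2 : σ (Finsupp.linearCombination ℂ (powRep d) ((a - b).filter (· ∉ Z))) ∈
        verSub d {Q} := by
      rw [Finsupp.linearCombination_apply, Finsupp.sum, map_sum]
      refine Submodule.sum_mem _ fun x hx => ?_
      rw [Finsupp.support_filter, Finset.mem_filter] at hx
      have hxW := (hT x hx.1).resolve_right hx.2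
      have h3 := hπ _ (mem_projectivization_iff.1 hxW)
      rw [hQspan] at h3
      obtain ⟨t, ht⟩ := Submodule.mem_span_singleton.1 h3
      rw [map_smul, powRep, hσ, ← ht, powForm_smul]
      exact Submodule.smul_mem _ _ (Submodule.smul_mem _ _ (powRep_mem_verSub rfl))
    rw [h1] at h0
    rw [eq_neg_of_add_eq_zero_left h0]
    exact Submodule.neg_mem _ h2
  have hmin := D.minA.inter D.suppA D.sumA Z
  have hmem : Finsupp.linearCombination ℂ (powRep d) (a.filter (· ∈ Z)) ∈
      verSub d (toC '' R ∩ Z ∪ {Q}) := by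
    have h1 : a.filter (· ∈ Z) = b.filter (· ∈ Z) + (a - b).filter (· ∈ Z) := by
      ext x
      by_cases hx : x ∈ Z <;> simp [hx]
    rw [h1, map_add, verSub_union, ← D.suppB]
    exact Submodule.add_mem_sup (linearCombination_filter_mem b Z) hpart
  refine (hmin.2.2 _ ((D.finite_image.subset Set.inter_subset_left).union
    (Set.finite_singleton Q)) hmem).trans ?_
  refine (Set.ncard_union_le _ _).trans ?_
  rw [Set.ncard_singleton]

lemma two_le_ncard_of_meeting_lines (D : Decompositions p A R a b r) (hd : 3 ≤ d)
    {W W' : Submodule ℂ (Fin (m + 1) → ℂ)} (hW : Module.finrank ℂ W = 2)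
    (hW' : Module.finrank ℂ W' = 2) (hne : W ≠ W') (hdis : ¬ Disjoint W W')
    (hT : ∀ x ∈ (a - b).support, x ∈ W.projectivization ∨ x ∈ W'.projectivization)
    (hTW : ∃ x ∈ (a - b).support, x ∉ W.projectivization) :
    2 ≤ (toC '' R ∩ W'.projectivization).ncard := by
  obtain ⟨e, rfl⟩ : ∃ e, d = e + 1 := ⟨d - 1, by omega⟩
  have h1 := D.cayleyBacharach.ncard_sdiff_ge hTW
  have h2 := D.ncard_support_inter_le_add W'.projectivization
  have h3 := D.ncard_inter_le_add_one hW hW' hne hdis hT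
  have h4 : (((a - b).support : Set (PSpace ℂ m)) \ W.projectivization).ncard ≤
      (((a - b).support : Set (PSpace ℂ m)) ∩ W'.projectivization).ncard :=
    Set.ncard_le_ncard (fun x hx => ⟨hx.1, (hT x hx.1).resolve_left hx.2⟩)
      ((a - b).support.finite_toSet.subset Set.inter_subset_left)
  omega

/-- The case in which the relation is supported on a plane conic, but not on a line. -/
lemma conicCase (D : Decompositions p A R a b r) (hlt : A.ncard < R.ncard)
    (hsum : A.ncard + R.ncard + 1 ≤ 3 * d)
    (hno : ∀ W : Submodule ℂ (Fin (m + 1) → ℂ), Module.finrank ℂ W = 2 →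
      ∃ x ∈ (a - b).support, x ∉ W.projectivization)
    {W : Submodule ℂ (Fin (m + 1) → ℂ)} {q : QuadraticForm ℂ (Fin (m + 1) → ℂ)}
    (hW : Module.finrank ℂ W = 3) (hq0 : ∃ w ∈ W, q w ≠ 0)
    (hT : ∀ x ∈ (a - b).support, x ∈ W.projectivization ∧ q x.rep = 0) : ConicCase d A R := by
  set C : Set (PSpace ℂ m) := {x | x ∈ W.projectivization ∧ q x.rep = 0} with hC
  have hTC : ((a - b).support : Set (PSpace ℂ m)) ⊆ C := hT
  have hne := D.support_nonempty hlt
  have hrel := D.filter_relation hTC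
  have hinter := Set.inter_eq_left.2 hTC
  have hCB := D.cayleyBacharach
  have hcard2 := hCB.card_ge (pairwiseIndep_repSet _) (hne.image _)
  rw [card_repSet] at hcard2
  have hcard : 2 * d + 2 ≤ (a - b).support.card := by
    by_contra! hlt
    obtain ⟨L, hL, hTL⟩ := hCB.collinear (pairwiseIndep_repSet _) (by rw [card_repSet]; omega)
    obtain ⟨x, hx, hxL⟩ := hno L (le_antisymm hL
      ((pairwiseIndep_repSet _).two_le_finrank hTL (by rw [card_repSet]; omega)))
    exact hxL (mem_projectivization_iff.2 (forall_mem_repSet.1 hTL x hx))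
  have h1 := D.ncard_support_inter_le C
  have h2 := D.ncard_support_inter_le_add C
  rw [hinter, Set.ncard_coe_finset] at h1 h2
  have h3 := D.ncard_inter_lt hlt (D.sdiff_eq hTC)
  have h4 := D.card_support_le
  have hd3 : 3 ≤ d := by omega
  obtain ⟨e, rfl⟩ : ∃ e, d = e + 1 := ⟨d - 1, by omega⟩
  have hreal : DefinedOverReal C := by
    by_cases hirr : ∀ L ≤ W, Module.finrank ℂ L = 2 → ∃ w ∈ L, q w ≠ 0
    · rw [← Set.image_inter_preimage, Set.ncard_image_of_injective _ toC_injective] at h2 h3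
      have hfin : (R ∩ toC ⁻¹' C).Finite := D.minR.1.subset Set.inter_subset_left
      rw [Set.ncard_eq_toFinset_card _ hfin] at h2 h3
      obtain ⟨S, hSR, hS⟩ := Finset.exists_subset_card_eq
        (by omega : 5 ≤ hfin.toFinset.card)
      have hSC : ∀ s ∈ S, toC s ∈ C := fun s hs => (hfin.mem_toFinset.1 (hSR hs)).2
      exact definedOverReal_conic hW hirr hS (fun s hs => (hSC s hs).1) fun s hs => (hSC s hs).2
    · push Not at hirr
      obtain ⟨L, hLW, hL, hLq⟩ := hirr
      obtain ⟨γ, h, hγh, hγ, hγL⟩ := exists_linear_factors hLW (by omega) hLq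
      obtain ⟨w, hw, hqw⟩ := hq0
      set L' := W ⊓ LinearMap.ker h with hL'def
      have hL' : Module.finrank ℂ L' = 2 := by
        have : Module.finrank ℂ L' + 1 = Module.finrank ℂ W :=
          finrank_inf_ker ⟨w, hw, fun h0 => hqw (by rw [hγh w hw, h0, mul_zero])⟩
        omega
      have hCL : C = (L.projectivization : Set (PSpace ℂ m)) ∪ L'.projectivization := by
        ext x
        simp only [hC, Set.mem_ofPred_eq, Set.mem_union, SetLike.mem_coe,
          mem_projectivization_iff]
        constructor
        · rintro ⟨hx, hqx⟩
          rw [hγh _ hx, mul_eq_zero] at hqx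
          exact hqx.imp (hγ _ hx) fun h0 => ⟨hx, h0⟩
        · rintro (hx | hx)
          · exact ⟨hLW hx, hLq _ hx⟩
          · have h0 : h x.rep = 0 := hx.2
            exact ⟨hx.1, by rw [hγh _ hx.1, h0, mul_zero]⟩
      have hTL : ∀ x ∈ (a - b).support, x ∈ L.projectivization ∨ x ∈ L'.projectivization :=
        fun x hx => (Set.ext_iff.1 hCL x).1 (hTC hx)
      have hneL : L ≠ L' := by
        intro heq
        obtain ⟨x, hx, hxL⟩ := hno L hL
        exact hxL ((hTL x hx).elim id fun h => heq ▸ h)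
      have hdis : ¬ Disjoint L L' := by
        intro hdis
        have h5 := Submodule.finrank_sup_add_finrank_inf_eq L L'
        rw [disjoint_iff.1 hdis, finrank_bot] at h5
        have h6 : Module.finrank ℂ (L ⊔ L' : Submodule ℂ (Fin (m + 1) → ℂ)) ≤ _ :=
          Submodule.finrank_mono (sup_le hLW inf_le_left)
        omega
      rw [hCL]
      exact (definedOverReal_of_two_le_ncard hL D.minR.1
        (D.two_le_ncard_of_meeting_lines hd3 hL' hL hneL.symm (fun h => hdis h.symm)
          (fun x hx => (hTL x hx).symm) (hno L' hL'))).union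
        (definedOverReal_of_two_le_ncard hL' D.minR.1
          (D.two_le_ncard_of_meeting_lines hd3 hL hL' hneL hdis hTL (hno L hL)))
  have hlines : ∀ (l₁ l₂ : Set (PSpace ℂ m)) (Q : PSpace ℂ m), IsLine l₂ → C ⊆ l₁ ∪ l₂ →
      Q ∈ l₂ → e + 1 + 1 ≤ ((A ∪ toC '' R) ∩ (l₁ \ {Q})).ncard := by
    rintro l₁ _ Q ⟨W₂, hW₂, rfl⟩ hC12 hQ
    refine (hCB.ncard_sdiff_ge (hno W₂ hW₂)).trans (Set.ncard_le_ncard ?_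
      ((D.minA.1.union D.finite_image).subset Set.inter_subset_left))
    intro x hx
    exact ⟨D.support_subset hx.1, (hC12 (hTC hx.1)).resolve_right hx.2, fun h => hx.2 (h ▸ hQ)⟩
  refine ⟨C, ⟨W, q, hW, ?_, rfl⟩, hreal, D.sdiff_eq hTC,
    D.exists_point hrel (by rw [hinter]; exact hne), by omega, h3, ?_⟩
  · rintro ⟨L, hL⟩
    obtain ⟨w, hw, hqw⟩ := hq0
    have h5 := finrank_inf_ker (W := W) (h := L) ⟨w, hw, fun h0 => hqw (by
      rw [hL w hw, h0]; ring)⟩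
    obtain ⟨x, hx, hxL⟩ := hno (W ⊓ LinearMap.ker L) (by omega)
    have hxW := mem_projectivization_iff.1 (hT x hx).1
    refine hxL (mem_projectivization_iff.2 ⟨hxW, ?_⟩)
    have h6 := hL _ hxW
    rw [(hT x hx).2] at h6
    exact pow_eq_zero_iff two_ne_zero |>.1 h6.symm
  · intro l₁ l₂ Q hl₁ hl₂ hCl hQ
    have hQ' : Q ∈ l₁ ∩ l₂ := hQ ▸ rfl
    exact ⟨hlines l₁ l₂ Q hl₂ hCl.le hQ'.2, hlines l₂ l₁ Q hl₁ (by rw [Set.union_comm, hCl]) hQ'.1⟩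

end Decompositions

end Cases

/-! ### Relations supported on two disjoint lines -/

section TwoLines

variable {m d : ℕ} {p : Form ℝ m d} {A : Set (PSpace ℂ m)} {R : Set (PSpace ℝ m)}
  {a b : PSpace ℂ m →₀ ℂ} {r : PSpace ℝ m →₀ ℝ}

lemma span_sup_inf_eq {K V : Type} [Field K] [AddCommGroup V] [Module K V] {N F : Submodule K V}
    {u o : V} (hu : u - o ∈ N) (ho : o ∈ F) (h : N ⊓ F = ⊥) :
    (Submodule.span K {u} ⊔ N) ⊓ F = Submodule.span K {o} := by
  apply le_antisymm
  · rintro x ⟨hx, hxF⟩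
    obtain ⟨y, hy, z, hz, rfl⟩ := Submodule.mem_sup.1 hx
    obtain ⟨t, rfl⟩ := Submodule.mem_span_singleton.1 hy
    have h1 : t • u + z - t • o ∈ N ⊓ F := by
      refine ⟨?_, F.sub_mem hxF (F.smul_mem t ho)⟩
      have : t • u + z - t • o = t • (u - o) + z := by rw [smul_sub]; abel
      rw [this]
      exact N.add_mem (N.smul_mem t hu) hz
    rw [h, Submodule.mem_bot, sub_eq_zero] at h1
    exact Submodule.mem_span_singleton.2 ⟨t, h1.symm⟩
  · rw [Submodule.span_singleton_le_iff_mem]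
    refine ⟨?_, ho⟩
    have : o = u + -(u - o) := by abel
    rw [this]
    exact Submodule.add_mem_sup (Submodule.mem_span_singleton_self u) (N.neg_mem hu)

/-- Points that forms vanishing on `Γ` separate from one another and from `Γ` span a linear space
disjoint from the one spanned by `Γ`. -/
lemma verSub_inf_eq_bot {S Γ : Set (PSpace ℂ m)}
    (h : ∀ x ∈ S, ∃ G : MvPolynomial (Fin (m + 1)) ℂ, G.IsHomogeneous d ∧
      (∀ y ∈ Γ, eval y.rep G = 0) ∧ (∀ y ∈ S, y ≠ x → eval y.rep G = 0) ∧ eval x.rep G ≠ 0) :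
    verSub d S ⊓ verSub d Γ = ⊥ := by
  rw [eq_bot_iff]
  rintro f ⟨hfS, hfΓ⟩
  obtain ⟨a, haS, rfl⟩ := mem_verSub_iff.1 hfS
  obtain ⟨a', haΓ, haa'⟩ := mem_verSub_iff.1 hfΓ
  have hrel : Finsupp.linearCombination ℂ (powRep d) (a - a') = 0 := by
    rw [map_sub, haa', sub_self]
  have ha : a = 0 := by
    ext x
    by_contra hax
    have hxS : x ∈ S := haS (Finsupp.mem_support_iff.2 hax)
    obtain ⟨G, hG, hGΓ, hGS, hGx⟩ := h x hxS
    have ha'x : a' x = 0 := by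
      by_contra h0
      exact hGx (hGΓ x (haΓ (Finsupp.mem_support_iff.2 h0)))
    have hsum := sum_eval_eq_zero hrel hG
    rw [Finsupp.sum, Finset.sum_eq_single x] at hsum
    · rw [Finsupp.sub_apply, ha'x, sub_zero] at hsum
      exact (mul_ne_zero hax hGx) hsum
    · intro y hy hyx
      rcases Finset.mem_union.1 (Finsupp.support_sub hy) with hy | hy
      · rw [hGS y (haS hy) hyx, mul_zero]
      · rw [hGΓ y (haΓ hy), mul_zero]
    · intro hx
      rw [Finsupp.notMem_support_iff.1 hx, zero_mul]
  simp [ha]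

lemma exists_verSub_projection (hd : d ≠ 0) {W W' : Submodule ℂ (Fin (m + 1) → ℂ)}
    (hdis : Disjoint W W') : ∃ σ : Form ℂ m d →ₗ[ℂ] Form ℂ m d,
      (∀ f ∈ verSub d (W.projectivization : Set (PSpace ℂ m)), σ f = f) ∧
      ∀ f ∈ verSub d (W'.projectivization : Set (PSpace ℂ m)), σ f = 0 := by
  obtain ⟨π, hπ, hπ'⟩ := exists_projection hdis
  obtain ⟨σ, hσ⟩ := exists_substitution π d
  have h1 : verSub d (W.projectivization : Set (PSpace ℂ m)) ≤
      LinearMap.ker (σ - LinearMap.id) := by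
    rw [verSub, Submodule.span_le]
    rintro _ ⟨x, hx, rfl⟩
    rw [SetLike.mem_coe, LinearMap.mem_ker, LinearMap.sub_apply, powRep, hσ,
      hπ _ (mem_projectivization_iff.1 hx), LinearMap.id_apply, sub_self]
  have h2 : verSub d (W'.projectivization : Set (PSpace ℂ m)) ≤ LinearMap.ker σ := by
    rw [verSub, Submodule.span_le]
    rintro _ ⟨x, hx, rfl⟩
    rw [SetLike.mem_coe, LinearMap.mem_ker, powRep, hσ,
      hπ' _ (mem_projectivization_iff.1 hx), powForm_zero hd]
  exact ⟨σ, fun f hf => sub_eq_zero.1 (h1 hf), fun f hf => h2 hf⟩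

lemma verSub_lines_inf_eq_bot (hd : d ≠ 0) {W W' : Submodule ℂ (Fin (m + 1) → ℂ)}
    (hdis : Disjoint W W') : verSub d (W.projectivization : Set (PSpace ℂ m)) ⊓
      verSub d (W'.projectivization : Set (PSpace ℂ m)) = ⊥ := by
  obtain ⟨σ, hσ, hσ'⟩ := exists_verSub_projection hd hdis
  rw [eq_bot_iff]
  rintro f ⟨hf, hf'⟩
  rw [Submodule.mem_bot, ← hσ f hf, hσ' f hf']

lemma disjoint_projectivization {W W' : Submodule ℂ (Fin (m + 1) → ℂ)} (hdis : Disjoint W W') :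
    Disjoint (W.projectivization : Set (PSpace ℂ m)) W'.projectivization := by
  rw [Set.disjoint_left]
  intro x hx hx'
  refine x.rep_nonzero ?_
  rw [← Submodule.mem_bot ℂ, ← disjoint_iff.1 hdis]
  exact ⟨mem_projectivization_iff.1 hx, mem_projectivization_iff.1 hx'⟩

namespace Decompositions

/-- A relation supported on two disjoint lines restricts to each of them. -/
lemma filter_relation_of_disjoint (D : Decompositions p A R a b r) (hd : d ≠ 0)
    {W W' : Submodule ℂ (Fin (m + 1) → ℂ)} (hdis : Disjoint W W')
    (hT : ∀ x ∈ (a - b).support, x ∈ W.projectivization ∨ x ∈ W'.projectivization) :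
    Finsupp.linearCombination ℂ (powRep d)
      ((a - b).filter (· ∈ (W.projectivization : Set (PSpace ℂ m)))) = 0 := by
  obtain ⟨σ, hσ, hσ'⟩ := exists_verSub_projection hd hdis
  set l : Set (PSpace ℂ m) := (W.projectivization : Set (PSpace ℂ m)) with hl
  have h0 := congrArg σ D.relation
  rw [map_zero, ← Finsupp.filter_add_filter_not (a - b) (· ∈ l), map_add, map_add,
    hσ _ (verSub_mono Set.inter_subset_right (linearCombination_filter_mem _ l)),
    hσ' _ (verSub_mono ?_ (linearCombination_filter_notMem (a - b) l)), add_zero] at h0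
  · exact h0
  · exact fun x hx => (hT x hx.1).resolve_left hx.2

lemma ncard_line_ge (D : Decompositions p A R a b r) (hd : d ≠ 0)
    {W W' : Submodule ℂ (Fin (m + 1) → ℂ)} (hdis : Disjoint W W')
    (hT : ∀ x ∈ (a - b).support, x ∈ W.projectivization ∨ x ∈ W'.projectivization)
    (hno : ∃ x ∈ (a - b).support, x ∉ W'.projectivization) :
    (((a - b).support : Set (PSpace ℂ m)) ∩ W.projectivization).Nonempty ∧
      d + 2 ≤ (((a - b).support : Set (PSpace ℂ m)) ∩ W.projectivization).ncard := by
  obtain ⟨x, hx, hxW'⟩ := hno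
  have hxW := (hT x hx).resolve_right hxW'
  refine ⟨⟨x, hx, hxW⟩, ?_⟩
  have h1 := (cayleyBacharach_support (D.filter_relation_of_disjoint hd hdis hT)).card_ge
    (pairwiseIndep_repSet _) ⟨x.rep, Finset.mem_image_of_mem _ (by
      rw [Finsupp.support_filter, Finset.mem_filter]
      exact ⟨hx, hxW⟩)⟩
  rw [card_repSet, ← Set.ncard_coe_finset, Finsupp.support_filter, Finset.coe_filter] at h1
  exact h1

/-- The case in which the relation is supported on two disjoint lines, but not on one of them. -/
lemma twoLinesCase (D : Decompositions p A R a b r) (hp : p ≠ 0)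
    (hsum : A.ncard + R.ncard + 1 ≤ 3 * d)
    (hno : ∀ W : Submodule ℂ (Fin (m + 1) → ℂ), Module.finrank ℂ W = 2 →
      ∃ x ∈ (a - b).support, x ∉ W.projectivization)
    {W W' : Submodule ℂ (Fin (m + 1) → ℂ)} (hW : Module.finrank ℂ W = 2)
    (hW' : Module.finrank ℂ W' = 2) (hdis : Disjoint W W')
    (hT : ∀ x ∈ (a - b).support, x ∈ W.projectivization ∨ x ∈ W'.projectivization) :
    TwoLinesCase d (Projectivization.mk ℝ p hp) A R := by
  have hd : d ≠ 0 := by omega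
  set l : Set (PSpace ℂ m) := (W.projectivization : Set (PSpace ℂ m)) with hl
  set l' : Set (PSpace ℂ m) := (W'.projectivization : Set (PSpace ℂ m)) with hl'
  have hdisl : Disjoint l l' := disjoint_projectivization hdis
  have hm : 3 ≤ m := by
    have h1 := Submodule.finrank_sup_add_finrank_inf_eq W W'
    have h2 := Submodule.finrank_le (W ⊔ W')
    rw [disjoint_iff.1 hdis, finrank_bot] at h1
    simp at h2
    omega
  have hTΓ : ((a - b).support : Set (PSpace ℂ m)) ⊆ l ∪ l' := hT
  have hT' : ∀ x ∈ (a - b).support, x ∈ W'.projectivization ∨ x ∈ W.projectivization :=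
    fun x hx => (hT x hx).symm
  have hrel := D.filter_relation_of_disjoint hd hdis hT
  have hrel' := D.filter_relation_of_disjoint hd hdis.symm hT'
  have hrelΓ := D.filter_relation hTΓ
  obtain ⟨hne, hge⟩ := D.ncard_line_ge hd hdis hT (hno W' hW')
  obtain ⟨hne', hge'⟩ := D.ncard_line_ge hd hdis.symm hT' (hno W hW)
  rw [← hl] at hrel hne hge
  rw [← hl'] at hrel' hne' hge'
  have hsdiff := D.sdiff_eq hTΓ
  -- The points off the two lines belong to both decompositions, so there are few of them.
  have hoff : 2 * (A \ (l ∪ l')).ncard + 2 * d + 4 + 1 ≤ 3 * d := by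
    have h1 := Set.ncard_inter_add_ncard_sdiff_eq_ncard A (l ∪ l') D.minA.1
    have h2 := Set.ncard_inter_add_ncard_sdiff_eq_ncard (toC '' R) (l ∪ l') D.finite_image
    rw [Set.ncard_image_of_injective _ toC_injective, ← hsdiff] at h2
    have h3 := D.ncard_support_inter_le_add (l ∪ l')
    rw [Set.inter_union_distrib_left, Set.ncard_union_eq
      (hdisl.mono Set.inter_subset_right Set.inter_subset_right)
      ((a - b).support.finite_toSet.subset Set.inter_subset_left)
      ((a - b).support.finite_toSet.subset Set.inter_subset_left)] at h3
    omega
  have hindep : verSub d (A \ (l ∪ l')) ⊓ verSub d (l ∪ l') = ⊥ := by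
    refine verSub_inf_eq_bot fun x hx => ?_
    obtain ⟨e, rfl⟩ : ∃ e, d = e + 1 + 1 := ⟨d - 2, by omega⟩
    have hfin : (A \ (l ∪ l')).Finite := D.minA.1.sdiff
    have hxW : x.rep ∉ W := fun h => hx.2 (Or.inl (mem_projectivization_iff.2 h))
    have hxW' : x.rep ∉ W' := fun h => hx.2 (Or.inr (mem_projectivization_iff.2 h))
    obtain ⟨f, hfx, hf⟩ := Submodule.exists_le_ker_of_notMem hxW
    obtain ⟨f', hfx', hf'⟩ := Submodule.exists_le_ker_of_notMem hxW'
    obtain ⟨G, hG, hG0, hGx⟩ := exists_form_separating (d := e)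
      (repSet (hfin.toFinset.erase x)) x.rep x.rep_nonzero
      (forall_mem_repSet.2 fun y hy h => (Finset.mem_erase.1 hy).1 (rep_mem_span_iff.1 h).symm)
      (by
        rw [card_repSet]
        have h1 := Finset.card_erase_le (s := hfin.toFinset) (a := x)
        rw [← Set.ncard_eq_toFinset_card _ hfin] at h1
        omega)
    refine ⟨G * dualPoly f * dualPoly f', (hG.mul (dualPoly_isHomogeneous f)).mul
      (dualPoly_isHomogeneous f'), ?_, fun y hy hyx => ?_, ?_⟩
    · rintro y (hy | hy)
      · have : f y.rep = 0 := hf (mem_projectivization_iff.1 hy)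
        simp [this]
      · have : f' y.rep = 0 := hf' (mem_projectivization_iff.1 hy)
        simp [this]
    · have := forall_mem_repSet.1 hG0 y (Finset.mem_erase.2 ⟨hyx, hfin.mem_toFinset.2 hy⟩)
      simp [this]
    · simpa using ⟨⟨hGx, hfx⟩, hfx'⟩
  have h0 := D.partForm_ne_zero hrel hne
  have h0' := D.partForm_ne_zero hrel' hne'
  have h0Γ := D.partForm_ne_zero hrelΓ
    (hne.mono (Set.inter_subset_inter_right _ Set.subset_union_left))
  obtain ⟨e1, e2, -, -⟩ := D.restrict hrel
  obtain ⟨e1', e2', -, -⟩ := D.restrict hrel'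
  obtain ⟨e1Γ, e2Γ, -, -⟩ := D.restrict hrelΓ
  have hmem := verSub_mono Set.inter_subset_right e2.2.1
  have hmem' := verSub_mono Set.inter_subset_right e2'.2.1
  have hmemΓ := verSub_mono Set.inter_subset_right e2Γ.2.1
  have hadd : formToComplex (partForm d r (l ∪ l')) =
      formToComplex (partForm d r l) + formToComplex (partForm d r l') := by
    rw [e1, e1', e1Γ, ← map_add]
    congr 1
    ext x
    by_cases hx : x ∈ l
    · simp [hx, Set.disjoint_left.1 hdisl hx]
    · by_cases hx' : x ∈ l' <;> simp [hx, hx']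
  have hsub : formToComplex p - formToComplex (partForm d r (l ∪ l')) ∈
      verSub d (A \ (l ∪ l')) := by
    rw [e1Γ, ← D.sumA, ← D.suppA]
    exact linearCombination_sub_filter_mem a _
  refine ⟨hm, l, l', ⟨W, hW, rfl⟩, ⟨W', hW', rfl⟩, ?_, ?_, hdisl, hsdiff,
    hge.trans (D.ncard_support_inter_le l), hge'.trans (D.ncard_support_inter_le l'),
    Projectivization.mk ℝ _ h0Γ, Projectivization.mk ℝ _ h0, Projectivization.mk ℝ _ h0',
    ?_, D.evincesBothOn hrelΓ h0Γ, ?_, D.evincesBothOn hrel h0, ?_, D.evincesBothOn hrel' h0'⟩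
  · have h1 := D.ncard_support_inter_le_add l
    have h2 := D.ncard_inter_le hrel
    exact definedOverReal_of_two_le_ncard hW D.minR.1 (by rw [← hl]; omega)
  · have h1 := D.ncard_support_inter_le_add l'
    have h2 := D.ncard_inter_le hrel'
    exact definedOverReal_of_two_le_ncard hW' D.minR.1 (by rw [← hl']; omega)
  · rw [formToC_mk, formToC_mk, span_insert_veronese, verSpan_eq]
    exact coe_inter_eq_singleton _ (span_sup_inf_eq hsub hmemΓ hindep)
  · rw [formToC_mk, formToC_mk, span_insert_veronese, verSpan_eq]
    refine coe_inter_eq_singleton _ (span_sup_inf_eq ?_ hmem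
      (verSub_lines_inf_eq_bot hd hdis.symm))
    rw [hadd, add_sub_cancel_left]
    exact hmem'
  · rw [formToC_mk, formToC_mk, span_insert_veronese, verSpan_eq]
    refine coe_inter_eq_singleton _ (span_sup_inf_eq ?_ hmem' (verSub_lines_inf_eq_bot hd hdis))
    rw [hadd, add_sub_cancel_right]
    exact hmem

end Decompositions

end TwoLines

end VeroneseRank

theorem theorem1 (m d : ℕ) (P : FormSpace ℝ m d)
    (hsum : symRank (formToC P) + symRank P + 1 ≤ 3 * d)
    (hne : symRank (formToC P) ≠ symRank P)
    (SC : Set (PSpace ℂ m)) (SR : Set (PSpace ℝ m))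
    (hSC : Evinces SC (formToC P)) (hSR : Evinces SR P) :
    LineCase d SC SR ∨ ConicCase d SC SR ∨ TwoLinesCase d P SC SR := by
  rw [← hSC.2.2, ← hSR.2.2] at hsum hne
  induction P using Projectivization.ind with
  | h p hp =>
  rw [formToC_mk, evinces_mk_iff] at hSC
  rw [evinces_mk_iff] at hSR
  obtain ⟨a, b, r, D⟩ := exists_decompositions hSC hSR
  have hlt : SC.ncard < SR.ncard := by
    refine lt_of_le_of_ne ?_ hne
    rw [← Set.ncard_image_of_injective SR toC_injective]
    refine D.minA.2.2 _ D.finite_image ?_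
    have h1 := D.relation
    rw [map_sub, D.sumA, sub_eq_zero] at h1
    exact mem_verSub_iff.2 ⟨b, D.suppB.le, h1.symm⟩
  by_cases hline : ∃ W : Submodule ℂ (Fin (m + 1) → ℂ), Module.finrank ℂ W = 2 ∧
      ∀ x ∈ (a - b).support, x ∈ W.projectivization
  · obtain ⟨W, hW, hT⟩ := hline
    exact Or.inl (D.lineCase hlt (by omega) hW hT)
  push Not at hline
  right
  have hc := D.card_support_le
  rcases D.cayleyBacharach.line_or_lines_or_conic (pairwiseIndep_repSet _)
    (by rw [card_repSet]; omega) ((D.support_nonempty hlt).image _) with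
    ⟨W, hW, hT⟩ | ⟨W, W', hW, hW', hdis, hT⟩ | ⟨W, q, hW, hq, hT⟩
  · obtain ⟨x, hx, hxW⟩ := hline W hW
    exact absurd (mem_projectivization_iff.2 (forall_mem_repSet.1 hT x hx)) hxW
  · refine Or.inr (D.twoLinesCase hp hsum hline hW hW' hdis fun x hx => ?_)
    rw [mem_projectivization_iff, mem_projectivization_iff]
    exact forall_mem_repSet.1 hT x hx
  · refine Or.inl (D.conicCase hlt hsum hline hW hq fun x hx => ?_)
    rw [mem_projectivization_iff]
    exact forall_mem_repSet.1 hT x hx
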